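/- Let $m \ge 1$ be an integer, let $\mathbb{S}^m \subset \mathbb{R}^{m+1}$ be the unit sphere with its surface measure, and let $\mathcal{N}$ be a compact (smooth, boundaryless) Riemannian manifold with geodesic distance $d_{\mathcal{N}}$ (equal to $+\infty$ between points of different components). A map $f \in C(\mathbb{S}^m, \mathcal{N})$ is said to have a *free homotopy decomposition* into maps $f_1, \dotsc, f_k \in C(\mathbb{S}^m, \mathcal{N})$ ($k \ge 0$) if there exist a map $g \in C(\mathbb{S}^m, \mathcal{N})$ homotopic to $f$ and pairwise disjoint open geodesic balls $B_{\rho_1}(a_1), \dotsc, B_{\rho_k}(a_k) \subset \mathbb{S}^m$ with $0 < \rho_i < \pi$ such that $g$ is constant on $\mathbb{S}^m \setminus \bigcup_{i=1}^k B_{\rho_i}(a_i)$ and, for every $i \in \{1, \dotsc, k\}$, the map induced by $g\vert_{\bar B_{\rho_i}(a_i)}$ on $\bar B_{\rho_i}(a_i) / \partial B_{\rho_i}(a_i) \simeq \mathbb{S}^m$ is homotopic to $f_i$. Here all homotopies are free (no base point), and the identification $\bar B_{\rho}(a) / \partial B_{\rho}(a) \simeq \mathbb{S}^m$ is the orientation-preserving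 one that sends the point at geodesic distance $\theta \le \rho$ from $a$ in a given direction to the point at geodesic distance $\pi \theta/\rho$ from $a$ in the same direction. **Theorem** (Free homotopy decompositions controlled by a gap potential). There exists $\varepsilon_0 > 0$, depending only on $m$ and $\mathcal{N}$, such that for every $\varepsilon \in (0, \varepsilon_0)$ there is a constant $C > 0$ such that for every $\lambda > 0$ there exists a finite set $\mathcal{F}^\lambda \subset C(\mathbb{S}^m, \mathcal{N})$ with the following property: every map $f \in C(\mathbb{S}^m, \mathcal{N})$ satisfying $$ \iint_{\substack{(x,y) \in \mathbb{S}^m \times \mathbb{S}^m \\ d_{\mathcal{N}}(f(y), f(x)) > \varepsilon}} \frac{1}{|y - x|^{2m}} \, \mathrm{d}y \, \mathrm{d}x \le \lambda $$ has a free homotopy decomposition into some maps $f_1, \dotsc, f_k \in \mathcal{F}^\lambda$ with $k \le C \lambda$. -/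

import Mathlib

open scoped Manifold ContDiff ENNReal Bundle

/-- The unit sphere `𝕊^m` of `ℝ^{m+1}`. -/
abbrev Sph (m : ℕ) : Type :=
  Metric.sphere (0 : EuclideanSpace ℝ (Fin (m + 1))) 1

/-- The geodesic distance on the round sphere `𝕊^m`: the angle between two unit vectors. -/
noncomputable def geodDist {m : ℕ} (x y : Sph m) : ℝ :=
  InnerProductGeometry.angle (x : EuclideanSpace ℝ (Fin (m + 1))) (y : EuclideanSpace ℝ (Fin (m + 1)))

/-- The open geodesic ball `B_ρ(a)` of `𝕊^m`. -/
def geodBall {m : ℕ} (a : Sph m) (ρ : ℝ) : Set (Sph m) :=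
  {x | geodDist a x < ρ}

/-- The closed geodesic ball of `𝕊^m`. -/
def geodClosedBall {m : ℕ} (a : Sph m) (ρ : ℝ) : Set (Sph m) :=
  {x | geodDist a x ≤ ρ}

/-- The vector `cos α • a + sin α • w`, where `w` is the unit tangent vector at `a` that points
along the great circle from `a` to `x`, and `α = π * min (θ / ρ) 1`, `θ` being the geodesic
distance from `a` to `x`. When `x = ± a` and `0 < ρ ≤ π`, one has `sin α = 0`. -/
noncomputable def collapseVec {m : ℕ} (a : Sph m) (ρ : ℝ) (x : Sph m) :
    EuclideanSpace ℝ (Fin (m + 1)) :=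
  Real.cos (Real.pi * min (geodDist a x / ρ) 1) • (a : EuclideanSpace ℝ (Fin (m + 1))) +
    (Real.sin (Real.pi * min (geodDist a x / ρ) 1) * (Real.sin (geodDist a x))⁻¹) •
      ((x : EuclideanSpace ℝ (Fin (m + 1))) -
        Real.cos (geodDist a x) • (a : EuclideanSpace ℝ (Fin (m + 1))))

lemma norm_collapseVec {m : ℕ} (a : Sph m) {ρ : ℝ} (hρ : 0 < ρ) (hρ' : ρ < Real.pi) (x : Sph m) :
    ‖collapseVec a ρ x‖ = 1 := by
  have ha : ‖(a : EuclideanSpace ℝ (Fin (m + 1)))‖ = 1 := by simp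
  have hx : ‖(x : EuclideanSpace ℝ (Fin (m + 1)))‖ = 1 := by simp
  have hc : inner ℝ (a : EuclideanSpace ℝ (Fin (m + 1))) (x : EuclideanSpace ℝ (Fin (m + 1)))
      = Real.cos (geodDist a x) := by
    rw [geodDist, InnerProductGeometry.cos_angle, ha, hx]; simp
  have hc' : inner ℝ (x : EuclideanSpace ℝ (Fin (m + 1))) (a : EuclideanSpace ℝ (Fin (m + 1)))
      = Real.cos (geodDist a x) := by
    rw [real_inner_comm, hc]
  have h0 : 0 ≤ geodDist a x := InnerProductGeometry.angle_nonneg _ _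
  have h1 : geodDist a x ≤ Real.pi := InnerProductGeometry.angle_le_pi _ _
  have key : ‖collapseVec a ρ x‖ ^ 2 = 1 := by
    rw [collapseVec]
    generalize hθ : geodDist a x = θ at *
    generalize hα : Real.pi * min (θ / ρ) 1 = α
    have hsin : Real.sin θ = 0 → Real.sin α = 0 := by
      intro h
      rcases h0.eq_or_lt with h2 | h2
      · subst hα; simp [← h2]
      · rcases h1.eq_or_lt with h3 | h3
        · have : (1 : ℝ) ≤ θ / ρ := by rw [le_div_iff₀ hρ]; linarith
          subst hα; simp [min_eq_right this]
        · exact absurd h (Real.sin_pos_of_pos_of_lt_pi h2 h3).ne'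
    have e1 : Real.sin θ ^ 2 = 1 - Real.cos θ ^ 2 := by
      have := Real.sin_sq_add_cos_sq θ; linarith
    have e2 := Real.sin_sq_add_cos_sq α
    have e3 : (Real.sin α * (Real.sin θ)⁻¹) ^ 2 * Real.sin θ ^ 2 = Real.sin α ^ 2 := by
      by_cases h : Real.sin θ = 0
      · simp [h, hsin h]
      · field_simp
    rw [norm_add_sq_real, norm_smul, norm_smul, mul_pow, mul_pow, norm_sub_sq_real, norm_smul,
      inner_smul_left, inner_smul_right, inner_sub_right, inner_smul_right, inner_smul_right,
      hc', hc, real_inner_self_eq_norm_sq, ha, hx]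
    simp only [Real.norm_eq_abs, sq_abs, mul_pow, conj_trivial, one_pow, mul_one]
    rw [mul_pow] at e3
    rw [e1] at e3
    nlinarith
  have := norm_nonneg (collapseVec a ρ x)
  nlinarith

/-- The radial quotient map `𝕊^m → 𝕊^m` that collapses the complement of `B_ρ(a)` to `-a`
and stretches the ball along the great circles through `a`: the point at geodesic distance
`θ ≤ ρ` from `a` in some direction goes to the point at geodesic distance `π θ / ρ` from `a` in
the same direction. Restricted to the closed ball, it induces the orientation-preserving
identification of the closed ball modulo its boundary with `𝕊^m`. -/
noncomputable def collapse {m : ℕ} (a : Sph m) {ρ : ℝ} (hρ : 0 < ρ) (hρ' : ρ < Real.pi)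
    (x : Sph m) : Sph m :=
  ⟨collapseVec a ρ x, by simpa using norm_collapseVec a hρ hρ' x⟩

/-- `f` has a free homotopy decomposition into `F 0, …, F (k - 1)`. -/
def HasFreeHomotopyDecomposition {m : ℕ} {N : Type*} [TopologicalSpace N]
    (f : C(Sph m, N)) {k : ℕ} (F : Fin k → C(Sph m, N)) : Prop :=
  ∃ (g : C(Sph m, N)) (a : Fin k → Sph m) (ρ : Fin k → ℝ)
    (hρ : ∀ i, 0 < ρ i) (hρ' : ∀ i, ρ i < Real.pi),
    g.Homotopic f ∧
    Pairwise (fun i j => Disjoint (geodBall (a i) (ρ i)) (geodBall (a j) (ρ j))) ∧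
    (∃ c : N, ∀ x, x ∉ ⋃ i, geodBall (a i) (ρ i) → g x = c) ∧
    -- the map induced by `g` on each quotient `closed ball / boundary ≃ 𝕊^m` is homotopic to `F i`
    ∀ i, ∃ h : C(Sph m, N),
      (∀ x ∈ geodClosedBall (a i) (ρ i), g x = h (collapse (a i) (hρ i) (hρ' i) x)) ∧
      h.Homotopic (F i)

/-- The gap potential of `f` at scale `ε`, with respect to the surface measure of `𝕊^m`
and the chordal distance `|y - x|` of `ℝ^{m+1}`. -/
noncomputable def gapPotential {m : ℕ} {N : Type*} [EMetricSpace N]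
    (ε : ℝ) (f : C(Sph m, N)) : ℝ≥0∞ :=
  ∫⁻ p in {p : Sph m × Sph m | ENNReal.ofReal ε < edist (f p.2) (f p.1)},
    ENNReal.ofReal (1 / dist p.2 p.1 ^ (2 * m))
      ∂((MeasureTheory.volume : MeasureTheory.Measure (EuclideanSpace ℝ (Fin (m + 1)))).toSphere.prod
        (MeasureTheory.volume : MeasureTheory.Measure (EuclideanSpace ℝ (Fin (m + 1)))).toSphere)

/-! Embed `N` in a Euclidean space by `φ`, with a retraction `r` of a neighbourhood of the image,
and extend u = φ ∘ f to ℝ^{m+1}: radially outside the unit ball, and inside it by averaging the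
radial extension over a ball whose radius is half the distance to the sphere. Wherever this
extension is close to φ(N), composing with `r` extends `f` itself. The topology of `f` is thus
concentrated around the bad points, where the average is far from φ(N).

Bad points are counted in the Poincaré ball, where sinh²(d/2) = |x - y|² / ((1 - |x|²)(1 - |y|²)).
At a bad point of depth s the average is far from every value of u, which forces a set of pairs of
measure at least of order s^{2m}, inside the shadow of the point on the sphere, at which f jumps by
more than ε (`le_prod_toSphere_of_averageExtension_far`). For hyperbolically separated points, the
overlap of the shadows weighted by s^{-2m} is bounded by the kernel 1/|y - x|^{2m}
(`sum_overlap_le`). Integrating over the gap set leaves at most Cλ separated bad points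
(`card_le_of_separated`).

Hyperbolic balls around a maximal separated family cover the bad set, and merging them
(`exists_merge`) makes them disjoint, with sizes bounded in terms of λ. They are also Euclidean
balls, and the extension is Lipschitz for the hyperbolic metric, so its rescaled restrictions to
their boundaries are equi-Lipschitz; by Arzelà–Ascoli they retract to finitely many homotopy classes
(`exists_finite_homotopy_classes`).

The rest is topology (`hasFreeHomotopyDecomposition_of_balls`): a map defined off disjoint balls
lets `f` be deformed, by shrinking the sphere inwards, until it runs along a bouquet of teardrops,
one around each ball. -/

open Set Metric Topology Filter MeasureTheory

/-! ### Neighbourhood retractions of embedded compact manifolds -/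

/-- A local retraction onto (the image of) a set extends over a further compact set contained in
a chart. -/
lemma exists_retraction_extend_chart {N H W : Type*} [TopologicalSpace N] [CompactSpace N]
    [T2Space N] [NormedAddCommGroup H] [NormedSpace ℝ H] [FiniteDimensional ℝ H] [MetricSpace W]
    {φ : N → W} (hφ : IsClosedEmbedding φ)
    (ψ : OpenPartialHomeomorph N H) {S K : Set N} (hS : IsCompact S) (hK : IsCompact K)
    (hKψ : K ⊆ ψ.source) (r : W → N) {O : Set W} (hO : IsOpen O) (hSO : φ '' S ⊆ O)
    (hr : ContinuousOn r O) (hrφ : ∀ p, φ p ∈ O → r (φ p) = p) :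
    ∃ (r' : W → N) (O' : Set W), IsOpen O' ∧ φ '' (S ∪ K) ⊆ O' ∧ ContinuousOn r' O' ∧
      ∀ p, φ p ∈ O' → r' (φ p) = p := by
  classical
  rcases isEmpty_or_nonempty N with hN | hN
  · refine ⟨r, O, hO, ?_, hr, hrφ⟩
    rintro _ ⟨p, -, -⟩
    exact hN.elim p
  have hSc : IsCompact (φ '' S) := hS.image hφ.continuous
  have hKc : IsCompact (φ '' K) := hK.image hφ.continuous
  obtain ⟨e, he, heO⟩ := hSc.exists_cthickening_subset_open hO hSO
  set C := cthickening e (φ '' S) with hC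
  have hCc : IsClosed C := isClosed_cthickening
  have hinv : ContinuousOn (Function.invFun φ) (range φ) := by
    intro y hy
    obtain ⟨p, rfl⟩ := hy
    rw [ContinuousWithinAt, Function.leftInverse_invFun hφ.injective p,
      ← hφ.isInducing.map_nhds_eq, tendsto_map'_iff]
    exact tendsto_id.congr fun x => (Function.leftInverse_invFun hφ.injective x).symm
  -- On φ(N) the only possible value is the inverse of `φ`, and `r` agrees with it where both are
  -- defined. Gluing over two closed sets gives a continuous map on C ∪ φ(N).
  set r₁ : W → N := fun y => if y ∈ C then r y else Function.invFun φ y with hr₁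
  have hr₁C : ∀ y ∈ C, r₁ y = r y := fun y hy => by simp [hr₁, hy]
  have hr₁φ : ∀ p, r₁ (φ p) = p := by
    intro p
    by_cases h : φ p ∈ C
    · rw [hr₁C _ h, hrφ _ (heO h)]
    · simp only [hr₁, if_neg h]
      exact Function.leftInverse_invFun hφ.injective p
  have hr₁c : ContinuousOn r₁ (C ∪ range φ) := by
    refine ContinuousOn.union_of_isClosed ((hr.mono heO).congr hr₁C) (hinv.congr ?_) hCc
      hφ.isClosed_range
    rintro _ ⟨p, rfl⟩
    rw [hr₁φ, Function.leftInverse_invFun hφ.injective p]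
  set B := C ∪ range φ with hB
  have hBc : IsClosed B := hCc.union hφ.isClosed_range
  obtain ⟨O₁, hO₁, hO₁B⟩ := continuousOn_iff'.1 hr₁c _ ψ.open_source
  have hKO₁ : φ '' K ⊆ O₁ := by
    rintro _ ⟨p, hp, rfl⟩
    have : φ p ∈ r₁ ⁻¹' ψ.source ∩ B := ⟨by simpa [hr₁φ] using hKψ hp, Or.inr ⟨p, rfl⟩⟩
    rw [hO₁B] at this
    exact this.1
  obtain ⟨e', he', heO'⟩ := hKc.exists_cthickening_subset_open hO₁ hKO₁
  set D := cthickening e' (φ '' K) with hD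
  have hDB : ∀ y ∈ B ∩ D, r₁ y ∈ ψ.source := by
    intro y hy
    have : y ∈ O₁ ∩ B := ⟨heO' hy.2, hy.1⟩
    rw [← hO₁B] at this
    exact this.1
  have hcont : ContinuousOn (fun y => ψ (r₁ y)) (B ∩ D) :=
    ψ.continuousOn.comp (hr₁c.mono inter_subset_left) hDB
  -- Near φ(K) the glued map takes values in one chart, so in coordinates it is a map into a vector
  -- space and Tietze extends it. Shrinking the neighbourhood of φ(K) then keeps the extension in
  -- the target of the chart, so that it can be read back in `N`.
  have : TietzeExtension H := TietzeExtension.of_tvs ℝ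
  obtain ⟨h, hh⟩ := ContinuousMap.exists_restrict_eq (hBc.inter isClosed_cthickening)
    (⟨_, continuousOn_iff_continuous_domRestrict.1 hcont⟩ : C(↥(B ∩ D), H))
  have hh' : ∀ y ∈ B ∩ D, h y = ψ (r₁ y) := fun y hy =>
    congrArg (fun g : C(↥(B ∩ D), H) => g ⟨y, hy⟩) hh
  have hKD : ∀ p ∈ K, φ p ∈ B ∩ D := fun p hp =>
    ⟨Or.inr ⟨p, rfl⟩, self_subset_cthickening _ ⟨p, hp, rfl⟩⟩
  obtain ⟨e₂, he₂, heO₂⟩ := hKc.exists_cthickening_subset_open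
    (isOpen_thickening.inter (ψ.open_target.preimage h.continuous))
    (show φ '' K ⊆ thickening e' (φ '' K) ∩ h ⁻¹' ψ.target by
      rintro _ ⟨p, hp, rfl⟩
      refine ⟨self_subset_thickening he' _ ⟨p, hp, rfl⟩, ?_⟩
      rw [mem_preimage, hh' _ (hKD p hp), hr₁φ]
      exact ψ.map_source (hKψ hp))
  set D₂ := cthickening e₂ (φ '' K) with hD₂
  have hD₂D : D₂ ⊆ D := fun y hy => thickening_subset_cthickening _ _ (heO₂ hy).1
  have hsymm : ∀ y ∈ B ∩ D₂, ψ.symm (h y) = r₁ y := fun y hy => by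
    rw [hh' y ⟨hy.1, hD₂D hy.2⟩, ψ.left_inv (hDB y ⟨hy.1, hD₂D hy.2⟩)]
  set r' : W → N := fun y => if y ∈ C then r₁ y else ψ.symm (h y) with hr'
  have hr'C : ∀ y ∈ C, r' y = r₁ y := fun y hy => by simp [hr', hy]
  have hr'D : ∀ y ∈ D₂, r' y = ψ.symm (h y) := fun y hy => by
    by_cases hyC : y ∈ C
    · rw [hr'C y hyC, hsymm y ⟨Or.inl hyC, hy⟩]
    · simp [hr', hyC]
  have hc : ContinuousOn r' (C ∪ D₂) := by
    refine ContinuousOn.union_of_isClosed ((hr₁c.mono subset_union_left).congr hr'C)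
      (ContinuousOn.congr ?_ hr'D) hCc isClosed_cthickening
    exact ψ.symm.continuousOn.comp h.continuous.continuousOn fun y hy => (heO₂ hy).2
  have hsub : thickening e (φ '' S) ∪ thickening e₂ (φ '' K) ⊆ C ∪ D₂ :=
    union_subset_union (thickening_subset_cthickening _ _) (thickening_subset_cthickening _ _)
  refine ⟨r', thickening e (φ '' S) ∪ thickening e₂ (φ '' K),
    isOpen_thickening.union isOpen_thickening, ?_, hc.mono hsub, ?_⟩
  · rw [image_union]
    exact union_subset_union (self_subset_thickening he _) (self_subset_thickening he₂ _)
  · intro p hp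
    rcases hsub hp with h1 | h1
    · rw [hr'C _ h1, hr₁φ]
    · rw [hr'D _ h1, hsymm _ ⟨Or.inr ⟨p, rfl⟩, h1⟩, hr₁φ]

/-- A compact topological manifold embedded in a metric space is a neighbourhood retract. -/
lemma exists_neighborhood_retraction {N H W : Type*} [TopologicalSpace N] [CompactSpace N]
    [T2Space N] [Nonempty N] [NormedAddCommGroup H] [NormedSpace ℝ H] [FiniteDimensional ℝ H]
    [ChartedSpace H N] [MetricSpace W] {φ : N → W} (hφ : IsClosedEmbedding φ) :
    ∃ (δ : ℝ) (r : W → N), 0 < δ ∧ ContinuousOn r {y | infDist y (range φ) < δ} ∧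
      ∀ p, r (φ p) = p := by
  have hnhds : ∀ x : N, ∃ K ∈ 𝓝 x, IsCompact K ∧ K ⊆ (chartAt H x).source := fun x => by
    obtain ⟨K, hK, hKs, hKc⟩ := LocallyCompactSpace.local_compact_nhds x _
      ((chartAt H x).open_source.mem_nhds (mem_chart_source H x))
    exact ⟨K, hK, hKc, hKs⟩
  choose K hK hKc hKs using hnhds
  obtain ⟨t, ht⟩ := CompactSpace.elim_nhds_subcover K hK
  -- The retraction is built by adding one compact chart piece at a time, over a finite cover of
  -- `N`.
  have key : ∀ s : Finset N, ∃ (r : W → N) (O : Set W), IsOpen O ∧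
      φ '' (⋃ x ∈ s, K x) ⊆ O ∧ ContinuousOn r O ∧ ∀ p, φ p ∈ O → r (φ p) = p := by
    classical
    intro s
    induction s using Finset.induction_on with
    | empty => exact ⟨fun _ => Classical.arbitrary N, ∅, isOpen_empty, by simp, by simp, by simp⟩
    | insert x s _ ih =>
      obtain ⟨r, O, hO, hsO, hr, hrφ⟩ := ih
      have := exists_retraction_extend_chart hφ (chartAt H x)
        (s.finite_toSet.isCompact_biUnion fun y _ => hKc y) (hKc x) (hKs x) r hO hsO hr hrφ
      rw [Finset.set_biUnion_insert, union_comm]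
      exact this
  obtain ⟨r, O, hO, htO, hr, hrφ⟩ := key t
  rw [ht, top_eq_univ, image_univ] at htO
  obtain ⟨δ, hδ, hδO⟩ := (isCompact_range hφ.continuous).exists_thickening_subset_open hO htO
  refine ⟨δ, r, hδ, hr.mono fun y hy => hδO ?_, fun p => hrφ p (htO ⟨p, rfl⟩)⟩
  rw [thickening_eq_biUnion_ball]
  obtain ⟨z, hz, hyz⟩ := (infDist_lt_iff (range_nonempty φ)).1 hy
  exact mem_iUnion₂.2 ⟨z, hz, hyz⟩

/-! ### Geodesic balls and continuity of the collapse map -/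

section Collapse

variable {m : ℕ}

local notation "V" => EuclideanSpace ℝ (Fin (m + 1))

lemma cos_geodDist (a x : Sph m) : Real.cos (geodDist a x) = inner ℝ (a : V) (x : V) := by
  rw [geodDist, InnerProductGeometry.cos_angle]; simp

lemma geodDist_nonneg (a x : Sph m) : 0 ≤ geodDist a x := InnerProductGeometry.angle_nonneg _ _

lemma geodDist_le_pi (a x : Sph m) : geodDist a x ≤ Real.pi :=
  InnerProductGeometry.angle_le_pi _ _

lemma geodDist_eq_arccos (a x : Sph m) :
    geodDist a x = Real.arccos (inner ℝ (a : V) (x : V)) := by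
  rw [← cos_geodDist, Real.arccos_cos (geodDist_nonneg a x) (geodDist_le_pi a x)]

lemma continuous_geodDist (a : Sph m) : Continuous (geodDist a) := by
  simp only [funext (geodDist_eq_arccos a)]
  exact Real.continuous_arccos.comp (by fun_prop)

lemma geodDist_lt_iff {a x : Sph m} {ρ : ℝ} (h0 : 0 ≤ ρ) (h1 : ρ ≤ Real.pi) :
    geodDist a x < ρ ↔ Real.cos ρ < inner ℝ (a : V) (x : V) := by
  rw [← cos_geodDist]
  exact (Real.strictAntiOn_cos.lt_iff_gt ⟨h0, h1⟩ ⟨geodDist_nonneg a x, geodDist_le_pi a x⟩).symm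

lemma geodDist_le_iff {a x : Sph m} {ρ : ℝ} (h0 : 0 ≤ ρ) (h1 : ρ ≤ Real.pi) :
    geodDist a x ≤ ρ ↔ Real.cos ρ ≤ inner ℝ (a : V) (x : V) := by
  rw [← cos_geodDist]
  exact (Real.strictAntiOn_cos.le_iff_ge ⟨h0, h1⟩ ⟨geodDist_nonneg a x, geodDist_le_pi a x⟩).symm

lemma geodDist_triangle (a x b : Sph m) : geodDist a b ≤ geodDist a x + geodDist b x := by
  rw [geodDist, geodDist, geodDist, InnerProductGeometry.angle_comm (b : V)]
  exact InnerProductGeometry.angle_le_angle_add_angle _ _ _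

lemma geodDist_pos {a b : Sph m} (h : a ≠ b) : 0 < geodDist a b := by
  refine (geodDist_nonneg a b).lt_of_ne fun h0 => h ?_
  have h1 : inner ℝ (a : V) (b : V) = 1 := by rw [← cos_geodDist, ← h0, Real.cos_zero]
  exact Subtype.ext ((inner_eq_one_iff_of_norm_eq_one (by simp) (by simp)).1 h1)

lemma norm_sub_cos_smul (a x : Sph m) :
    ‖(x : V) - Real.cos (geodDist a x) • (a : V)‖ = Real.sin (geodDist a x) := by
  have hs : 0 ≤ Real.sin (geodDist a x) :=
    Real.sin_nonneg_of_nonneg_of_le_pi (geodDist_nonneg a x) (geodDist_le_pi a x)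
  rw [← sq_eq_sq₀ (norm_nonneg _) hs, norm_sub_sq_real, norm_smul, inner_smul_right,
    real_inner_comm, ← cos_geodDist, Real.sin_sq]
  simp
  ring

lemma collapse_of_le {a : Sph m} {ρ : ℝ} (hρ : 0 < ρ) (hρ' : ρ < Real.pi) {x : Sph m}
    (h : ρ ≤ geodDist a x) : (collapse a hρ hρ' x : V) = -(a : V) := by
  have : min (geodDist a x / ρ) 1 = 1 := min_eq_right ((one_le_div hρ).2 h)
  simp [collapse, collapseVec, this]

lemma collapse_self (a : Sph m) {ρ : ℝ} (hρ : 0 < ρ) (hρ' : ρ < Real.pi) :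
    collapse a hρ hρ' a = a := by
  have h0 : geodDist a a = 0 := by
    rw [geodDist, InnerProductGeometry.angle_self (ne_of_apply_ne norm (by simp))]
  ext1
  simp [collapse, collapseVec, h0]

/-- The collapse map moves points along great circles through `a`. -/
lemma exists_collapse_eq (a : Sph m) {ρ : ℝ} (hρ : 0 < ρ) (hρ' : ρ < Real.pi) (x : Sph m) :
    ∃ s t : ℝ, 0 ≤ t ∧ (collapse a hρ hρ' x : V) =
      s • (a : V) + t • ((x : V) - Real.cos (geodDist a x) • (a : V)) := by
  refine ⟨_, _, mul_nonneg ?_ (inv_nonneg.2 ?_), rfl⟩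
  · have h1 : 0 ≤ min (geodDist a x / ρ) 1 :=
      le_min (div_nonneg (geodDist_nonneg a x) hρ.le) zero_le_one
    have h2 : min (geodDist a x / ρ) 1 ≤ 1 := min_le_right _ _
    exact Real.sin_nonneg_of_nonneg_of_le_pi (by positivity) (by nlinarith [Real.pi_pos])
  · exact Real.sin_nonneg_of_nonneg_of_le_pi (geodDist_nonneg a x) (geodDist_le_pi a x)

/-- The formula divides by sin θ, which vanishes at `a` and `-a`. At `a`, the tangential vector has
norm sin θ, so the quotient is harmless and the term is bounded by |sin α|, which tends to 0. Near
`-a` the map is constant, since ρ < π. -/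
lemma continuous_collapse (a : Sph m) {ρ : ℝ} (hρ : 0 < ρ) (hρ' : ρ < Real.pi) :
    Continuous (collapse a hρ hρ') := by
  have hg := continuous_geodDist a
  have hα : Continuous fun x : Sph m => Real.pi * min (geodDist a x / ρ) 1 :=
    continuous_const.mul ((hg.div_const ρ).min continuous_const)
  have h1 : Continuous fun x : Sph m =>
      Real.cos (Real.pi * min (geodDist a x / ρ) 1) • (a : V) :=
    (Real.continuous_cos.comp hα).smul continuous_const
  have h2 : Continuous fun x : Sph m => (x : V) - Real.cos (geodDist a x) • (a : V) :=
    continuous_subtype_val.sub ((Real.continuous_cos.comp hg).smul continuous_const)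
  refine Continuous.subtype_mk (continuous_iff_continuousAt.2 fun x => ?_) _
  rcases lt_or_ge ρ (geodDist a x) with hx | hx
  · have : ∀ᶠ y in 𝓝 x, collapseVec a ρ y = -(a : V) := by
      filter_upwards [hg.continuousAt.eventually (lt_mem_nhds hx)] with y hy
      exact collapse_of_le hρ hρ' hy.le
    exact (continuousAt_congr this).2 continuousAt_const
  refine h1.continuousAt.add ?_
  rcases (geodDist_nonneg a x).eq_or_lt with h0 | h0
  · have hz : Real.sin (Real.pi * min (geodDist a x / ρ) 1) = 0 := by simp [← h0]
    rw [ContinuousAt, hz, zero_mul, zero_smul]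
    have hlim : Tendsto (fun y : Sph m => |Real.sin (Real.pi * min (geodDist a y / ρ) 1)|)
        (𝓝 x) (𝓝 0) := by
      have := (Real.continuous_sin.comp hα).abs.tendsto x
      simpa [← h0] using this
    refine squeeze_zero_norm (fun y => ?_) hlim
    rw [norm_smul, norm_sub_cos_smul, Real.norm_eq_abs, abs_mul, mul_assoc]
    refine mul_le_of_le_one_right (abs_nonneg _) ?_
    have hs : 0 ≤ Real.sin (geodDist a y) :=
      Real.sin_nonneg_of_nonneg_of_le_pi (geodDist_nonneg a y) (geodDist_le_pi a y)
    rw [abs_inv, abs_of_nonneg hs]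
    exact inv_mul_le_one
  · have hs : Real.sin (geodDist a x) ≠ 0 :=
      (Real.sin_pos_of_pos_of_lt_pi h0 (hx.trans_lt hρ')).ne'
    exact ((Real.continuous_sin.comp hα).continuousAt.mul
      ((Real.continuous_sin.comp hg).continuousAt.inv₀ hs)).smul h2.continuousAt

end Collapse

/-! ### Decomposition around punctures seen in distinct directions -/

lemma homotopic_of_continuousOn {X Y Z : Type*} [TopologicalSpace X] [TopologicalSpace Y]
    [TopologicalSpace Z] {G : Y → Z} {S : Set Y} (hG : ContinuousOn G S)
    (H : unitInterval × X → Y) (hH : Continuous H) (hS : ∀ p, H p ∈ S) (f g : C(X, Z))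
    (hf : ∀ x, G (H (0, x)) = f x) (hg : ∀ x, G (H (1, x)) = g x) : f.Homotopic g :=
  ⟨⟨⟨fun p => G (H p), hG.comp_continuous hH hS⟩, hf, hg⟩⟩

section Bubbling

variable {m : ℕ}

local notation "V" => EuclideanSpace ℝ (Fin (m + 1))

lemma inner_sphere_le_one (a ξ : Sph m) : inner ℝ (ξ : V) (a : V) ≤ 1 := by
  simpa using real_inner_le_norm (ξ : V) (a : V)

lemma neg_one_le_inner_sphere (a ξ : Sph m) : -1 ≤ inner ℝ (ξ : V) (a : V) := by
  simpa using neg_le_of_abs_le (abs_real_inner_le_norm (ξ : V) (a : V))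

/-- A sphere of radius `e` around `c`, whose point in the direction `-a` is pulled to the
origin. -/
noncomputable def teardrop (a : Sph m) (c : V) (e : ℝ) (ξ : Sph m) : V :=
  ((1 + inner ℝ (ξ : V) (a : V)) / 2) • (c + e • (ξ : V))

lemma continuous_teardrop (a : Sph m) (c : V) (e : ℝ) : Continuous (teardrop a c e) := by
  unfold teardrop
  fun_prop

lemma teardrop_neg {a ξ : Sph m} (c : V) (e : ℝ) (h : (ξ : V) = -(a : V)) :
    teardrop a c e ξ = 0 := by
  simp [teardrop, h]

/-- The segment from a point of the teardrop to the corresponding point of the sphere avoids the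
centre. -/
lemma smul_add_smul_ne (a ξ : Sph m) {l e μ : ℝ} (hl : 0 < l) (he : 0 < e)
    (h1 : (1 + inner ℝ (ξ : V) (a : V)) / 2 ≤ μ) (h2 : μ ≤ 1) :
    μ • (l • (a : V) + e • (ξ : V)) ≠ l • (a : V) := by
  intro h
  have hμ0 : 0 ≤ μ := le_trans (by linarith [neg_one_le_inner_sphere a ξ]) h1
  have hμ : 0 < μ := hμ0.lt_of_ne fun h0 => by
    rw [← h0, zero_smul] at h
    have := congrArg norm h
    simp [norm_smul] at this
    exact (abs_pos.2 hl.ne').ne this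
  have h3 : (μ * e) • (ξ : V) = ((1 - μ) * l) • (a : V) := by
    linear_combination (norm := module) h
  have h4 : μ * e = (1 - μ) * l := by
    have := congrArg norm h3
    rw [norm_smul, norm_smul] at this
    simpa [abs_of_pos hμ, abs_of_pos he, abs_of_pos hl, abs_of_nonneg (sub_nonneg.2 h2)] using this
  have h5 : (ξ : V) = a := by
    rw [← h4] at h3
    exact smul_right_injective _ (mul_pos hμ he).ne' h3
  rw [h5, real_inner_self_eq_norm_sq] at h1
  simp at h1
  have : μ = 1 := le_antisymm h2 h1
  rw [this] at h4
  simp at h4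
  exact he.ne' h4

/-- Convexity of the cone about `a`. -/
lemma cone_add {a : V} {κ : ℝ} (hκ : 0 ≤ κ) {x y : V} (hx : κ * ‖x‖ ≤ inner ℝ x a)
    (hy : κ * ‖y‖ ≤ inner ℝ y a) : κ * ‖x + y‖ ≤ inner ℝ (x + y) a := by
  rw [inner_add_left]
  nlinarith [norm_add_le x y]

lemma cone_smul {a : V} {κ t : ℝ} (ht : 0 ≤ t) {x : V} (hx : κ * ‖x‖ ≤ inner ℝ x a) :
    κ * ‖t • x‖ ≤ inner ℝ (t • x) a := by
  rw [inner_smul_left, norm_smul, Real.norm_of_nonneg ht]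
  simp
  nlinarith

/-- A map defined off finitely many points of `ℝ^{m+1}`, seen from the origin in distinct
directions, decomposes freely into its restrictions to small spheres around these points. -/
lemma hasFreeHomotopyDecomposition_of_directions {N : Type*} [TopologicalSpace N] {k : ℕ}
    {G : V → N} (a : Fin k → Sph m) (l : Fin k → ℝ) (hl : ∀ j, 0 < l j)
    (ha : Function.Injective a) (hG : ContinuousOn G (range fun j => l j • (a j : V))ᶜ)
    (f : C(Sph m, N)) {R : ℝ} (hR0 : 0 < R) (hR : ∀ j, l j < R) 
    (hf : ∀ η : Sph m, G (R • (η : V)) = f η)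
    (b : Fin k → C(Sph m, N)) {e : ℝ} (he : 0 < e)
    (hb : ∀ j t, 0 < t → t ≤ e → ∀ ξ : Sph m, G (l j • (a j : V) + t • (ξ : V)) = b j ξ) :
    HasFreeHomotopyDecomposition f b := by
  classical
  -- The closed ρ-balls about the directions are disjoint, and ρ < π/2 makes cos ρ nonnegative, so
  -- the cones over these balls are convex.
  obtain ⟨ρ, hρd, hρ0, hρ2⟩ : ∃ ρ : ℝ, (∀ i j, i ≠ j → 2 * ρ < geodDist (a i) (a j)) ∧
      0 < ρ ∧ ρ < Real.pi / 2 := by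
    have h1 : ∀ i j, ∀ᶠ ρ : ℝ in 𝓝[>] 0, i ≠ j → 2 * ρ < geodDist (a i) (a j) := by
      intro i j
      by_cases hij : i = j
      · simp [hij]
      · have hpos := geodDist_pos (ha.ne hij)
        filter_upwards [Ioo_mem_nhdsGT (half_pos hpos)] with ρ hρ _
        linarith [hρ.2]
    obtain ⟨ρ, h, h'⟩ := ((eventually_all.2 fun i => eventually_all.2 (h1 i)).and
      (Ioo_mem_nhdsGT (half_pos Real.pi_pos))).exists
    exact ⟨ρ, h, h'.1, h'.2⟩
  have hρπ : ρ < Real.pi := by linarith [Real.pi_pos]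
  set κ := Real.cos ρ with hκ
  have hκ0 : 0 ≤ κ := Real.cos_nonneg_of_mem_Icc ⟨by linarith, hρ2.le⟩
  have hκ1 : κ < 1 := by
    have := Real.strictAntiOn_cos ⟨le_rfl, Real.pi_pos.le⟩ ⟨hρ0.le, hρπ.le⟩ hρ0
    rwa [Real.cos_zero] at this
  have hdisj : ∀ i j, i ≠ j → ∀ η : Sph m, geodDist (a i) η ≤ ρ → ¬ geodDist (a j) η ≤ ρ := by
    intro i j hij η hi hj
    linarith [geodDist_triangle (a i) η (a j), hρd i j hij]
  -- the cones
  have hcone : ∀ i j, i ≠ j → ¬ κ * ‖l i • (a i : V)‖ ≤ inner ℝ (l i • (a i : V)) (a j : V) := by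
    intro i j hij h
    rw [norm_smul, inner_smul_left, Real.norm_of_nonneg (hl i).le] at h
    simp only [norm_eq_of_mem_sphere, mul_one, conj_trivial] at h
    have h2 : κ ≤ inner ℝ (a i : V) (a j : V) := by nlinarith [hl i]
    have h3 := (geodDist_le_iff hρ0.le hρπ.le).2 h2
    linarith [hρd i j hij]
  -- This inequality puts the whole sphere of radius ε about each puncture inside the cone of its
  -- own direction.
  obtain ⟨ε, hε0, hεe, hεcone⟩ : ∃ ε : ℝ, 0 < ε ∧ ε ≤ e ∧
      ∀ j, κ * (l j + ε) ≤ l j - ε := by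
    have h1 : ∀ j, ∀ᶠ ε : ℝ in 𝓝[>] 0, κ * (l j + ε) ≤ l j - ε := by
      intro j
      have hpos : 0 < (1 - κ) * l j / 2 := by
        have := mul_pos (sub_pos.2 hκ1) (hl j)
        linarith
      filter_upwards [Ioo_mem_nhdsGT hpos] with ε hε
      nlinarith [hε.1, hε.2]
    obtain ⟨ε, h, h'⟩ := ((eventually_all.2 h1).and (Ioc_mem_nhdsGT he)).exists
    exact ⟨ε, h'.1, h'.2, h⟩
  set c : Fin k → V := fun j => l j • (a j : V) with hc
  have hsph : ∀ j (ξ : Sph m), κ * ‖c j + ε • (ξ : V)‖ ≤ inner ℝ (c j + ε • (ξ : V)) (a j : V) := by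
    intro j ξ
    have h1 : ‖c j + ε • (ξ : V)‖ ≤ l j + ε := by
      refine (norm_add_le _ _).trans (le_of_eq ?_)
      simp [hc, norm_smul, abs_of_pos (hl j), abs_of_pos hε0]
    have h2 : inner ℝ (c j + ε • (ξ : V)) (a j : V) = l j + ε * inner ℝ (ξ : V) (a j : V) := by
      simp [hc, inner_add_left, inner_smul_left]
    rw [h2]
    have h3 := neg_one_le_inner_sphere (a j) ξ
    nlinarith [hεcone j]
  have key1 : ∀ j (ξ : Sph m) (μ : ℝ), (1 + inner ℝ (ξ : V) (a j : V)) / 2 ≤ μ → μ ≤ 1 →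
      μ • (c j + ε • (ξ : V)) ∈ (range c)ᶜ := by
    rintro j ξ μ h1 h2 ⟨i, hi⟩
    by_cases hij : i = j
    · subst hij
      exact smul_add_smul_ne (a i) ξ (hl i) hε0 h1 h2 hi.symm
    · refine hcone i j hij ?_
      change κ * ‖c i‖ ≤ inner ℝ (c i) (a j : V)
      rw [hi]
      exact cone_smul (le_trans (by linarith [neg_one_le_inner_sphere (a j) ξ]) h1) (hsph j ξ)
  -- At most one summand is nonzero at a given point: `q` follows the j-th teardrop on the j-th ball
  -- and sits at the origin off all balls. The decomposed map is `G ∘ q`.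
  set q : Sph m → V := fun η => ∑ j, teardrop (a j) (c j) ε (collapse (a j) hρ0 hρπ η) with hq
  have hqc : Continuous q := continuous_finsetSum _ fun j _ =>
    (continuous_teardrop _ _ _).comp (continuous_collapse _ _ _)
  have hq0 : ∀ η, (∀ j, ρ ≤ geodDist (a j) η) → q η = 0 := fun η h =>
    Finset.sum_eq_zero fun j _ => teardrop_neg _ _ (collapse_of_le _ _ (h j))
  have hqj : ∀ η j, geodDist (a j) η ≤ ρ →
      q η = teardrop (a j) (c j) ε (collapse (a j) hρ0 hρπ η) := by
    intro η j h
    refine Finset.sum_eq_single_of_mem j (Finset.mem_univ j) fun i _ hij => ?_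
    exact teardrop_neg _ _ (collapse_of_le _ _ (not_le.1 (hdisj j i hij.symm η h)).le)
  -- The straight homotopy from the large sphere to `q` misses the punctures. Over the j-th ball it
  -- stays in the j-th cone, which contains no other puncture; over points off all balls it stays on
  -- a ray that points at no puncture. Only the puncture of the ball's own cone needs a computation.
  have key2 : ∀ (η : Sph m) (t : ℝ), 0 ≤ t → t ≤ 1 →
      (1 - t) • R • (η : V) + t • q η ∈ (range c)ᶜ := by
    rintro η t ht0 ht1 ⟨i, hi⟩
    rcases le_or_gt ρ (geodDist (a i) η) with hη | hη
    · by_cases hex : ∃ j, geodDist (a j) η < ρ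
      · obtain ⟨j, hj⟩ := hex
        have hij : i ≠ j := by
          rintro rfl
          linarith
        refine hcone i j hij ?_
        change κ * ‖c i‖ ≤ inner ℝ (c i) (a j : V)
        rw [hi, hqj η j hj.le]
        refine cone_add hκ0 (cone_smul (by linarith) (cone_smul hR0.le ?_)) (cone_smul ht0 ?_)
        · have := (geodDist_lt_iff hρ0.le hρπ.le).1 hj
          rw [real_inner_comm] at this
          simpa using this.le
        · exact cone_smul (by linarith [neg_one_le_inner_sphere (a j) (collapse (a j) hρ0 hρπ η)])
            (hsph j _)
      · push Not at hex
        rw [hq0 η hex, smul_zero, add_zero, smul_smul] at hi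
        have hn : l i = (1 - t) * R := by
          have := congrArg norm hi
          simpa [hc, norm_smul, abs_of_pos (hl i), abs_of_pos hR0,
            abs_of_nonneg (sub_nonneg.2 ht1)] using this
        have h5 : a i = η := by
          simp only [hc, ← hn] at hi
          exact Subtype.ext (smul_right_injective _ (hl i).ne' hi)
        rw [← h5, geodDist, InnerProductGeometry.angle_self (ne_of_apply_ne norm (by simp))] at hη
        linarith
    · rw [hqj η i hη.le] at hi
      set ξ := collapse (a i) hρ0 hρπ η with hξ
      rcases ht1.eq_or_lt with rfl | ht1
      · simp only [sub_self, zero_smul, one_smul, zero_add] at hi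
        exact smul_add_smul_ne (a i) ξ (hl i) hε0 le_rfl
          (by linarith [inner_sphere_le_one (a i) ξ]) hi.symm
      -- The collapse moves points along great circles, so both ends of the segment have nonnegative
      -- components along the tangential direction `w`. Hitting the puncture forces w = 0, so η = a
      -- i; on that ray both ends lie strictly beyond the puncture.
      obtain ⟨s, τ, hτ, hst⟩ := exists_collapse_eq (a i) hρ0 hρπ η
      set w : V := (η : V) - Real.cos (geodDist (a i) η) • (a i : V) with hw
      set lam := (1 + inner ℝ (ξ : V) (a i : V)) / 2 with hlam
      have hlam0 : 0 ≤ lam := by linarith [neg_one_le_inner_sphere (a i) ξ]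
      have hwa : inner ℝ w (a i : V) = 0 := by
        rw [hw, inner_sub_left, inner_smul_left, cos_geodDist, real_inner_comm,
          real_inner_self_eq_norm_sq]
        simp
      have hww : inner ℝ (η : V) w = inner ℝ w w := by
        conv_rhs => rw [hw]
        rw [inner_sub_left, inner_smul_left, real_inner_comm, real_inner_comm _ (a i : V), hwa]
        simp
      have hcw : inner ℝ (c i) w = 0 := by
        rw [hc, inner_smul_left, real_inner_comm, hwa, mul_zero]
      have hi2 := congrArg (fun y => inner ℝ y w) hi
      have hξw : inner ℝ (ξ : V) w = τ * inner ℝ w w := by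
        rw [hξ, hst, inner_add_left, inner_smul_left, inner_smul_left, real_inner_comm, hwa]
        simp
      simp only [hcw, teardrop, ← hlam, inner_add_left, inner_smul_left, hξw, hww,
        conj_trivial] at hi2
      have hpos : 0 < (1 - t) * R + t * lam * ε * τ := by
        have := mul_pos (sub_pos.2 ht1) hR0
        positivity
      have hww0 : inner ℝ w w = 0 := by
        have : ((1 - t) * R + t * lam * ε * τ) * inner ℝ w w = 0 := by linarith
        exact (mul_eq_zero.1 this).resolve_left hpos.ne'
      have hsin : Real.sin (geodDist (a i) η) = 0 := by
        rw [← norm_sub_cos_smul, ← hw, inner_self_eq_zero.1 hww0, norm_zero]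
      have hdist : geodDist (a i) η = 0 := by
        by_contra hne
        exact (Real.sin_pos_of_pos_of_lt_pi ((geodDist_nonneg _ _).lt_of_ne' hne)
          (hη.trans hρπ)).ne' hsin
      have hηa : η = a i := by
        by_contra hne
        exact (geodDist_pos (Ne.symm hne)).ne' hdist
      have hξa : ξ = a i := by rw [hξ, hηa, collapse_self]
      have hlam1 : lam = 1 := by
        rw [hlam, hξa, real_inner_self_eq_norm_sq]
        simp
      have hfin : l i = (1 - t) * R + t * (l i + ε) := by
        have := congrArg (fun y => inner ℝ y (a i : V)) hi
        simp only [teardrop, hξa, hηa, hc, inner_add_left,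
          inner_smul_left, conj_trivial, real_inner_self_eq_norm_sq, norm_eq_of_mem_sphere] at this
        linarith
      nlinarith [hR i, mul_pos (sub_pos.2 ht1) (sub_pos.2 (hR i)), mul_nonneg ht0 hε0.le]
  have hGq : Continuous fun η => G (q η) :=
    hG.comp_continuous hqc fun η => by simpa using key2 η 1 zero_le_one le_rfl
  have htear : ∀ j (ξ : Sph m), teardrop (a j) (c j) ε ξ ∈ (range c)ᶜ := fun j ξ =>
    key1 j ξ _ le_rfl (by linarith [inner_sphere_le_one (a j) ξ])
  refine ⟨⟨_, hGq⟩, a, fun _ => ρ, fun _ => hρ0, fun _ => hρπ, ?_, ?_, ⟨G 0, ?_⟩, fun j => ?_⟩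
  · refine ContinuousMap.Homotopic.symm ?_
    refine homotopic_of_continuousOn hG
      (fun p : unitInterval × Sph m => (1 - (p.1 : ℝ)) • R • (p.2 : V) + (p.1 : ℝ) • q p.2) (by fun_prop)
      (fun p => key2 p.2 p.1 p.1.2.1 p.1.2.2) _ _ (fun η => ?_) (fun η => ?_)
    · simpa using hf η
    · simp
  · intro i j hij
    refine Set.disjoint_left.2 fun η hi hj => hdisj i j hij η (le_of_lt hi) (le_of_lt hj)
  · intro η hη
    change G (q η) = G 0
    rw [hq0 η fun j => ?_]
    by_contra hlt
    exact hη (mem_iUnion.2 ⟨j, not_le.1 hlt⟩)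
  · refine ⟨⟨fun ξ => G (teardrop (a j) (c j) ε ξ),
      hG.comp_continuous (continuous_teardrop _ _ _) (htear j)⟩, fun η hη => ?_, ?_⟩
    · change G (q η) = G _
      rw [hqj η j hη]
    -- Raising the scalar factor to 1 opens the teardrop into the round sphere.
    · refine homotopic_of_continuousOn hG
        (fun p : unitInterval × Sph m => ((1 - (p.1 : ℝ)) * ((1 + inner ℝ (p.2 : V) (a j : V)) / 2) + (p.1 : ℝ)) •
          (c j + ε • (p.2 : V))) (by fun_prop) (fun p => ?_) _ _ (fun ξ => ?_) (fun ξ => ?_)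
      · have h1 := inner_sphere_le_one (a j) p.2
        have h2 := p.1.2.1
        have h3 := p.1.2.2
        refine key1 j p.2 _ ?_ ?_
        · nlinarith
        · nlinarith
      · simp [teardrop]
      · simpa using hb j ε hε0 hεe ξ

end Bubbling

/-! ### From general punctures to disjoint balls -/

section Balls

variable {m : ℕ}

local notation "V" => EuclideanSpace ℝ (Fin (m + 1))

lemma HasFreeHomotopyDecomposition.of_homotopic {N : Type*} [TopologicalSpace N] {k : ℕ}
    {f f' : C(Sph m, N)} {b : Fin k → C(Sph m, N)} (h : HasFreeHomotopyDecomposition f b)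
    (hf : f.Homotopic f') : HasFreeHomotopyDecomposition f' b := by
  obtain ⟨g, a, ρ, h1, h2, hg, h3⟩ := h
  exact ⟨g, a, ρ, h1, h2, hg.trans hf, h3⟩

lemma HasFreeHomotopyDecomposition.of_homotopic_right {N : Type*} [TopologicalSpace N] {k : ℕ}
    {f : C(Sph m, N)} {b b' : Fin k → C(Sph m, N)} (h : HasFreeHomotopyDecomposition f b)
    (hb : ∀ i, (b i).Homotopic (b' i)) : HasFreeHomotopyDecomposition f b' := by
  obtain ⟨g, a, ρ, h1, h2, hg, h3, h4, h5⟩ := h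
  refine ⟨g, a, ρ, h1, h2, hg, h3, h4, fun i => ?_⟩
  obtain ⟨u, hu, hub⟩ := h5 i
  exact ⟨u, hu, hub.trans (hb i)⟩

/-- In dimension at least two, finitely many points are seen in distinct directions from some
point. -/
lemma exists_notMem_affineSpan_pair (hm : 1 ≤ m) {k : ℕ} (c : Fin k → V) :
    ∃ x : V, ∀ i j, x ∉ affineSpan ℝ {c i, c j} := by
  have h : ∀ i j, ∀ᵐ x : V, x ∉ affineSpan ℝ {c i, c j} := by
    intro i j
    -- The span of two points is at most a line, hence a null set as m + 1 ≥ 2. The case i = j keeps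
    -- x away from the points themselves.
    refine MeasureTheory.measure_eq_zero_iff_ae_notMem.1
      (MeasureTheory.Measure.addHaar_affineSubspace _ _ fun htop => ?_)
    have h1 := (collinear_pair ℝ (c i) (c j)).finrank_le_one
    rw [← direction_affineSpan, htop, AffineSubspace.direction_top, finrank_top] at h1
    simp at h1
    omega
  exact (MeasureTheory.ae_all_iff.2 fun i => MeasureTheory.ae_all_iff.2 (h i)).exists

/-- Taking as new origin a point off all lines through two punctures makes the directions distinct.
Since `G` is radial outside the unit ball, its restriction to a large sphere about the new origin is
still homotopic to `f`. -/
lemma hasFreeHomotopyDecomposition_of_punctured (hm : 1 ≤ m) {N : Type*} [TopologicalSpace N]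
    {k : ℕ} {G : V → N} {c : Fin k → V} (hc : Function.Injective c)
    (hG : ContinuousOn G (range c)ᶜ) (hc1 : ∀ j, ‖c j‖ < 1) (f : C(Sph m, N))
    (hf : ∀ (t : ℝ) (η : Sph m), 1 ≤ t → G (t • (η : V)) = f η)
    (b : Fin k → C(Sph m, N)) {e : Fin k → ℝ} (he : ∀ j, 0 < e j)
    (hb : ∀ j t, 0 < t → t ≤ e j → ∀ ξ : Sph m, G (c j + t • (ξ : V)) = b j ξ) :
    HasFreeHomotopyDecomposition f b := by
  obtain ⟨x, hx⟩ := exists_notMem_affineSpan_pair hm c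
  obtain ⟨e₀, he₀, he₀'⟩ : ∃ e₀ : ℝ, 0 < e₀ ∧ ∀ j, e₀ ≤ e j := by
    obtain ⟨e₀, h, h'⟩ := ((eventually_all.2 fun j => Ioc_mem_nhdsGT (he j)).and
      self_mem_nhdsWithin).exists
    exact ⟨e₀, h', fun j => (h j).2⟩
  have hl : ∀ j, 0 < ‖c j - x‖ := fun j => norm_pos_iff.2 <| sub_ne_zero.2 fun h =>
    hx j j (h ▸ left_mem_affineSpan_pair ℝ _ _)
  set a : Fin k → Sph m := fun j => ⟨‖c j - x‖⁻¹ • (c j - x), by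
    simp [norm_smul, (hl j).ne']⟩ with ha
  have hla : ∀ j, ‖c j - x‖ • (a j : V) = c j - x := fun j => smul_inv_smul₀ (hl j).ne' _
  have hainj : Function.Injective a := by
    intro i j hij
    by_contra hne
    have hi := hla i
    have hj := hla j
    rw [← hij] at hj
    set p := ‖c i - x‖
    set q := ‖c j - x‖
    have hpq : q - p ≠ 0 := fun h0 => by
      have : p = q := by linarith
      rw [this, hj] at hi
      exact hne (hc (sub_left_injective hi)).symm
    have h1 : q • (c i - x) = p • (c j - x) := by
      rw [← hi, ← hj, smul_comm]
    refine hx i j ?_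
    -- If c i - x and c j - x are p and q times the same unit vector, then (q - p) x = q c i - p c
    -- j, so x lies on the line through the two punctures.
    have h2 : x = AffineMap.lineMap (c i) (c j) (-(p / (q - p))) := by
      rw [AffineMap.lineMap_apply_module]
      refine smul_right_injective V hpq ?_
      simp only [smul_add, smul_smul]
      have e1 : (q - p) * (1 - -(p / (q - p))) = q := by
        field_simp
        ring
      have e2 : (q - p) * -(p / (q - p)) = -p := by
        field_simp
      rw [e1, e2]
      linear_combination (norm := module) (-1 : ℝ) • h1
    rw [h2]
    exact AffineMap.lineMap_mem_affineSpan_pair _ _ _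
  -- Large enough for the sphere to contain every puncture and to stay outside the unit ball while
  -- its centre moves from x to 0.
  set R : ℝ := ‖x‖ + 2 with hR
  have hR0 : 0 < R := by positivity
  have hout : ∀ y : V, 1 ≤ ‖y‖ → y ∈ (range c)ᶜ := by
    rintro _ hy ⟨j, rfl⟩
    exact absurd hy (not_le.2 (hc1 j))
  have hseg : ∀ (t : ℝ) (η : Sph m), 0 ≤ t → t ≤ 1 → 1 ≤ ‖t • x + R • (η : V)‖ := by
    intro t η h0 h1
    have h2 : ‖R • (η : V)‖ = R := by simp [norm_smul, abs_of_pos hR0]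
    have h3 : ‖t • x‖ ≤ ‖x‖ := by
      rw [norm_smul, Real.norm_of_nonneg h0]
      exact mul_le_of_le_one_left (norm_nonneg _) h1
    have h4 := norm_sub_le (t • x + R • (η : V)) (t • x)
    rw [add_sub_cancel_left, h2] at h4
    linarith
  set fR : C(Sph m, N) := ⟨fun η => G (x + R • (η : V)), hG.comp_continuous (by fun_prop)
    fun η => hout _ (by simpa using hseg 1 η zero_le_one le_rfl)⟩
  have hhom : fR.Homotopic f := by
    refine homotopic_of_continuousOn hG
      (fun p : unitInterval × Sph m => (1 - (p.1 : ℝ)) • x + R • (p.2 : V)) (by fun_prop)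
      (fun p => hout _ (hseg _ _ (by linarith [p.1.2.2]) (by linarith [p.1.2.1]))) _ _
      (fun η => ?_) (fun η => ?_)
    · simp [fR]
    · simpa using hf R η (by linarith [norm_nonneg x])
  refine HasFreeHomotopyDecomposition.of_homotopic ?_ hhom
  refine hasFreeHomotopyDecomposition_of_directions (G := fun y => G (x + y)) a
    (fun j => ‖c j - x‖) hl hainj ?_ fR hR0 (fun j => ?_) (fun η => rfl) b he₀
    (fun j t h0 h1 ξ => ?_)
  · refine hG.comp (by fun_prop) ?_
    rintro y hy ⟨j, hj⟩
    exact hy ⟨j, (hla j).trans (by rw [hj, add_sub_cancel_left])⟩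
  · linarith [norm_sub_le (c j) x, hc1 j]
  · rw [hla, ← add_assoc, add_sub_cancel]
    exact hb j t h0 (h1.trans (he₀' j)) ξ

/-- A map defined off finitely many disjoint balls decomposes freely into its restrictions to the
boundaries of these balls. -/
lemma hasFreeHomotopyDecomposition_of_balls (hm : 1 ≤ m) {N : Type*} [TopologicalSpace N]
    {k : ℕ} {G : V → N} {c : Fin k → V} {R : Fin k → ℝ} (hR : ∀ j, 0 < R j)
    (hdisj : ∀ i j, i ≠ j → Disjoint (closedBall (c i) (R i)) (closedBall (c j) (R j)))
    (hsub : ∀ j, closedBall (c j) (R j) ⊆ ball 0 1)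
    (hG : ContinuousOn G (⋃ j, ball (c j) (R j))ᶜ) (f : C(Sph m, N))
    (hf : ∀ (t : ℝ) (η : Sph m), 1 ≤ t → G (t • (η : V)) = f η)
    (b : Fin k → C(Sph m, N)) (hb : ∀ j (ξ : Sph m), G (c j + R j • (ξ : V)) = b j ξ) :
    HasFreeHomotopyDecomposition f b := by
  classical
  have hcb : ∀ j, c j ∈ closedBall (c j) (R j) := fun j => mem_closedBall_self (hR j).le
  have hcinj : Function.Injective c := by
    intro i j hij
    by_contra hne
    exact Set.disjoint_left.1 (hdisj i j hne) (hcb i) (hij ▸ hcb j)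
  -- `P` pushes each punctured ball radially onto its boundary and fixes everything else;
  -- disjointness leaves at most one nonzero term. `G ∘ P` is then constant along the radii of each
  -- ball.
  set P : V → V := fun x => x + ∑ j, (max 1 (R j / ‖x - c j‖) - 1) • (x - c j) with hP
  have hterm : ∀ j x, R j ≤ ‖x - c j‖ → (max 1 (R j / ‖x - c j‖) - 1) • (x - c j) = 0 := by
    intro j x h
    rw [max_eq_left (div_le_one_of_le₀ h (norm_nonneg _)), sub_self, zero_smul]
  have hPout : ∀ x, (∀ j, R j ≤ ‖x - c j‖) → P x = x := by
    intro x h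
    simp [hP, Finset.sum_eq_zero fun j _ => hterm j x (h j)]
  have hPin : ∀ x j, ‖x - c j‖ ≤ R j → x ≠ c j →
      P x = c j + (R j / ‖x - c j‖) • (x - c j) := by
    intro x j h hne
    have h1 : 1 ≤ R j / ‖x - c j‖ := (one_le_div (norm_pos_iff.2 (sub_ne_zero.2 hne))).2 h
    have h2 : ∑ i, (max 1 (R i / ‖x - c i‖) - 1) • (x - c i) =
        (max 1 (R j / ‖x - c j‖) - 1) • (x - c j) := by
      refine Finset.sum_eq_single_of_mem j (Finset.mem_univ j) fun i _ hij => hterm i x ?_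
      by_contra hlt
      refine (fun h1 h2 => Set.disjoint_left.1 (hdisj i j hij) h1 h2 :
        x ∈ closedBall (c i) (R i) → x ∈ closedBall (c j) (R j) → False) ?_ ?_
      · rw [mem_closedBall, dist_eq_norm]
        exact (not_le.1 hlt).le
      · rwa [mem_closedBall, dist_eq_norm]
    rw [hP]
    simp only [h2, max_eq_right h1]
    module
  have hPsph : ∀ j (t : ℝ) (ξ : Sph m), 0 < t → t ≤ R j →
      P (c j + t • (ξ : V)) = c j + R j • (ξ : V) := by
    intro j t ξ h0 h1
    have hn : ‖c j + t • (ξ : V) - c j‖ = t := by simp [norm_smul, abs_of_pos h0]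
    rw [hPin _ j (by rwa [hn]) fun h => by rw [h] at hn; simp at hn; exact h0.ne hn, hn,
      add_sub_cancel_left, smul_smul, div_mul_cancel₀ _ h0.ne']
  have hmem : ∀ x ∈ (range c)ᶜ, P x ∈ (⋃ j, ball (c j) (R j))ᶜ := by
    intro x hx hmem
    obtain ⟨i, hi⟩ := mem_iUnion.1 hmem
    rw [mem_ball, dist_eq_norm] at hi
    by_cases h : ∀ j, R j ≤ ‖x - c j‖
    · rw [hPout x h] at hi
      exact absurd (h i) (not_le.2 hi)
    · push Not at h
      obtain ⟨j, hj⟩ := h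
      have hne : x ≠ c j := fun h => hx ⟨j, h.symm⟩
      have hpos : 0 < ‖x - c j‖ := norm_pos_iff.2 (sub_ne_zero.2 hne)
      rw [hPin x j hj.le hne] at hi
      have hn : ‖c j + (R j / ‖x - c j‖) • (x - c j) - c j‖ = R j := by
        rw [add_sub_cancel_left, norm_smul, norm_div, norm_norm,
          div_mul_cancel₀ _ hpos.ne', Real.norm_of_nonneg (hR j).le]
      by_cases hij : i = j
      · subst hij
        exact absurd hi (not_lt.2 hn.ge)
      · refine (fun h1 h2 => Set.disjoint_left.1 (hdisj i j hij) h1 h2 :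
          c j + (R j / ‖x - c j‖) • (x - c j) ∈ closedBall (c i) (R i) →
            c j + (R j / ‖x - c j‖) • (x - c j) ∈ closedBall (c j) (R j) → False) ?_ ?_
        · rw [mem_closedBall, dist_eq_norm]
          exact hi.le
        · rw [mem_closedBall, dist_eq_norm]
          exact hn.le
  have hPc : ContinuousOn P (range c)ᶜ := by
    refine continuousOn_id.add (continuousOn_finsetSum _ fun j _ => ?_)
    have h1 : ContinuousOn (fun x => R j / ‖x - c j‖) (range c)ᶜ :=
      continuousOn_const.div (by fun_prop) fun x hx =>
        norm_ne_zero_iff.2 (sub_ne_zero.2 fun h => hx ⟨j, h.symm⟩)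
    exact (((continuous_const.max continuous_id).comp_continuousOn h1).sub
      continuousOn_const).smul (by fun_prop)
  refine hasFreeHomotopyDecomposition_of_punctured hm (G := G ∘ P) hcinj (hG.comp hPc hmem)
    (fun j => by simpa using hsub j (hcb j)) f (fun t η ht => ?_) b hR
    (fun j t h0 h1 ξ => ?_)
  · rw [Function.comp_apply, hPout, hf t η ht]
    intro j
    by_contra hlt
    have := hsub j (show t • (η : V) ∈ closedBall (c j) (R j) by
      rw [mem_closedBall, dist_eq_norm]
      exact (not_le.1 hlt).le)
    rw [mem_ball_zero_iff, norm_smul] at this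
    simp at this
    linarith [le_abs_self t]
  · rw [Function.comp_apply, hPsph j t ξ h0 h1, hb]

end Balls

/-! ### Extension of sphere maps by averages -/

section Average

variable {m : ℕ}

local notation "V" => EuclideanSpace ℝ (Fin (m + 1))

/-- The radial projection onto the unit sphere, with an arbitrary value at the origin. -/
noncomputable def radialProj (y : V) : Sph m :=
  if h : y = 0 then ⟨EuclideanSpace.single 0 1, by simp⟩
  else ⟨‖y‖⁻¹ • y, by simp [norm_smul, h]⟩

lemma coe_radialProj {y : V} (h : y ≠ 0) : (radialProj y : V) = ‖y‖⁻¹ • y := by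
  simp [radialProj, h]

lemma radialProj_smul {t : ℝ} (ht : 0 < t) (η : Sph m) : radialProj (t • (η : V)) = η := by
  have h : t • (η : V) ≠ 0 := smul_ne_zero ht.ne' (ne_of_apply_ne norm (by simp))
  ext1
  rw [coe_radialProj h, norm_smul, norm_eq_of_mem_sphere, Real.norm_of_nonneg ht.le, mul_one,
    inv_smul_smul₀ ht.ne']

lemma continuousAt_radialProj {y : V} (h : y ≠ 0) : ContinuousAt (radialProj (m := m)) y := by
  rw [IsInducing.subtypeVal.continuousAt_iff]
  have : ∀ᶠ z in 𝓝 y, (Subtype.val ∘ radialProj (m := m)) z = ‖z‖⁻¹ • z := by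
    filter_upwards [isOpen_ne.mem_nhds h] with z hz
    exact coe_radialProj hz
  refine (continuousAt_congr this).2 (ContinuousAt.fun_smul ?_ (continuousAt_id' _))
  exact continuous_norm.continuousAt.inv₀ (norm_ne_zero_iff.2 h)

lemma measurable_radialProj : Measurable (radialProj (m := m)) :=
  measurable_of_continuousOn_compl_singleton 0 fun _ h =>
    (continuousAt_radialProj h).continuousWithinAt

/-- Half of the distance to the unit sphere, inside the unit ball. -/
noncomputable def halfDepth (x : V) : ℝ := max 0 ((1 - ‖x‖) / 2)

/-- The tent function `max (1 - |z|) 0`. -/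
noncomputable def tent (z : V) : ℝ := max 0 (1 - ‖z‖)

lemma continuous_halfDepth : Continuous (halfDepth (m := m)) := by
  unfold halfDepth
  fun_prop

lemma halfDepth_nonneg (x : V) : 0 ≤ halfDepth x := le_max_left _ _

lemma halfDepth_of_lt {x : V} (h : ‖x‖ < 1) : halfDepth x = (1 - ‖x‖) / 2 :=
  max_eq_right (by linarith)

lemma halfDepth_of_ge {x : V} (h : 1 ≤ ‖x‖) : halfDepth x = 0 :=
  max_eq_left (by linarith)

lemma halfDepth_pos {x : V} (h : ‖x‖ < 1) : 0 < halfDepth x := by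
  rw [halfDepth_of_lt h]
  linarith

lemma abs_halfDepth_sub_le (x y : V) : |halfDepth x - halfDepth y| ≤ ‖x - y‖ / 2 := by
  have h := abs_norm_sub_norm_le x y
  rw [abs_le] at h ⊢
  simp only [halfDepth]
  rcases max_cases 0 ((1 - ‖x‖) / 2) with h1 | h1 <;>
    rcases max_cases 0 ((1 - ‖y‖) / 2) with h2 | h2 <;> 
    constructor <;> linarith [h1.1, h1.2, h2.1, h2.2]

lemma tent_nonneg (z : V) : 0 ≤ tent z := le_max_left _ _

lemma tent_le_one (z : V) : tent z ≤ 1 := max_le zero_le_one (by linarith [norm_nonneg z])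

lemma continuous_tent : Continuous (tent (m := m)) := by
  unfold tent
  fun_prop

lemma tent_eq_zero {z : V} (h : 1 ≤ ‖z‖) : tent z = 0 := max_eq_left (by linarith)

lemma hasCompactSupport_tent : HasCompactSupport (tent (m := m)) :=
  HasCompactSupport.of_support_subset_isCompact (isCompact_closedBall 0 1) fun z hz => by
    by_contra h
    rw [mem_closedBall_zero_iff, not_le] at h
    exact hz (tent_eq_zero h.le)

lemma integrable_tent : Integrable (tent (m := m)) :=
  continuous_tent.integrable_of_hasCompactSupport hasCompactSupport_tent

variable (m) in
/-- The integral of the tent function. -/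
noncomputable def tentMass : ℝ := ∫ z : V, tent z

lemma tentMass_pos : 0 < tentMass m := by
  refine (integral_pos_iff_support_of_nonneg tent_nonneg integrable_tent).2 ?_
  refine (continuous_tent.isOpen_support).measure_pos _ ⟨0, ?_⟩
  simp [tent]

lemma aestronglyMeasurable_comp_radialProj {W : Type*} [NormedAddCommGroup W]
    (u : C(Sph m, W)) {g : V → V} (hg : Continuous g) :
    AEStronglyMeasurable (fun z => u (radialProj (g z))) volume :=
  (u.continuous.stronglyMeasurable.comp_measurable
    (measurable_radialProj.comp hg.measurable)).aestronglyMeasurable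

variable {W : Type*} [NormedAddCommGroup W] [NormedSpace ℝ W]

/-- The extension of a map on the sphere to the whole space, by averages inside the unit ball and
radially outside. -/
noncomputable def averageExtension (u : C(Sph m, W)) (x : V) : W :=
  (tentMass m)⁻¹ • ∫ z : V, tent z • u (radialProj (x + halfDepth x • z))

lemma averageExtension_of_one_le (u : C(Sph m, W)) [CompleteSpace W] {x : V} (h : 1 ≤ ‖x‖) :
    averageExtension u x = u (radialProj x) := by
  simp only [averageExtension, halfDepth_of_ge h, zero_smul, add_zero]
  rw [integral_smul_const, smul_smul]
  change ((tentMass m)⁻¹ * tentMass m) • _ = _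
  rw [inv_mul_cancel₀ tentMass_pos.ne', one_smul]

lemma integrable_tent_smul (u : C(Sph m, W)) {g : V → V} (hg : Continuous g) :
    Integrable (fun z => tent z • u (radialProj (g z))) := by
  refine (integrable_tent.mul_const ‖u‖).mono'
    (continuous_tent.aestronglyMeasurable.smul (aestronglyMeasurable_comp_radialProj u hg))
    (ae_of_all _ fun z => ?_)
  rw [norm_smul, Real.norm_of_nonneg (tent_nonneg z)]
  exact mul_le_mul_of_nonneg_left (u.norm_coe_le_norm _) (tent_nonneg z)

lemma norm_averageExtension_le (u : C(Sph m, W)) (x : V) : ‖averageExtension u x‖ ≤ ‖u‖ := by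
  rw [averageExtension, norm_smul, norm_inv, Real.norm_of_nonneg tentMass_pos.le,
    inv_mul_le_iff₀ tentMass_pos]
  refine (norm_integral_le_of_norm_le (integrable_tent.mul_const ‖u‖)
    (ae_of_all _ fun z => ?_)).trans (le_of_eq (integral_mul_const _ _))
  rw [norm_smul, Real.norm_of_nonneg (tent_nonneg z)]
  exact mul_le_mul_of_nonneg_left (u.norm_coe_le_norm _) (tent_nonneg z)

/-- Dominated convergence: for a given x, the radial projection is singular for at most one z, the
one sent to the origin, and a single point is negligible. -/
lemma continuous_averageExtension (u : C(Sph m, W)) : Continuous (averageExtension u) := by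
  refine Continuous.const_smul (continuous_iff_continuousAt.2 fun x => ?_) _
  have hne : ∀ᵐ z : V, x + halfDepth x • z ≠ 0 := by
    rcases lt_or_ge ‖x‖ 1 with hx | hx
    · have h0 := halfDepth_pos hx
      filter_upwards [measure_eq_zero_iff_ae_notMem.1
        (measure_singleton (μ := volume) (-((halfDepth x)⁻¹ • x)))] with z hz h
      refine hz ?_
      rw [mem_singleton_iff, ← smul_neg, eq_inv_smul_iff₀ h0.ne']
      exact eq_neg_of_add_eq_zero_right h
    · refine ae_of_all _ fun z h => ?_
      rw [halfDepth_of_ge hx, zero_smul, add_zero] at h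
      rw [h, norm_zero] at hx
      linarith
  refine continuousAt_of_dominated (bound := fun z => tent z * ‖u‖)
    (Eventually.of_forall fun y => (integrable_tent_smul u (by fun_prop)).aestronglyMeasurable)
    (Eventually.of_forall fun y => ae_of_all _ fun z => ?_) (integrable_tent.mul_const ‖u‖) ?_
  · rw [norm_smul, Real.norm_of_nonneg (tent_nonneg z)]
    exact mul_le_mul_of_nonneg_left (u.norm_coe_le_norm _) (tent_nonneg z)
  · filter_upwards [hne] with z hz
    refine continuousAt_const.smul (u.continuous.continuousAt.comp ?_)
    exact (continuousAt_radialProj hz).comp (f := fun y : V => y + halfDepth y • z)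
      (continuousAt_id.add (continuous_halfDepth.continuousAt.smul continuousAt_const))

end Average

/-! ### Hyperbolic Lipschitz estimate for averages -/

section Lipschitz

variable {m : ℕ}

local notation "V" => EuclideanSpace ℝ (Fin (m + 1))

variable {W : Type*} [NormedAddCommGroup W] [NormedSpace ℝ W]

/-- The unnormalized average over the ball `B(x, s)`. -/
noncomputable def coneAverage (u : C(Sph m, W)) (x : V) (s : ℝ) : W :=
  ∫ y : V, max 0 (s - ‖y - x‖) • u (radialProj y)

/-- Change of variables y = x + s z; the exponent m + 2 is m + 1 from the volume and 1 from the
height of the tent. -/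
lemma coneAverage_eq (u : C(Sph m, W)) (x : V) {s : ℝ} (hs : 0 < s) :
    coneAverage u x s = s ^ (m + 2) • ∫ z : V, tent z • u (radialProj (x + s • z)) := by
  have h1 : ∀ y : V, max 0 (s - ‖y - x‖) = s * tent (s⁻¹ • (y - x)) := by
    intro y
    rw [tent, mul_max_of_nonneg _ _ hs.le, norm_smul, norm_inv, Real.norm_of_nonneg hs.le, mul_sub,
      mul_inv_cancel_left₀ hs.ne', mul_one, mul_zero]
  have h2 := Measure.integral_comp_smul volume
    (fun y : V => tent (s⁻¹ • y) • u (radialProj (x + y))) s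
  simp only [inv_smul_smul₀ hs.ne'] at h2
  have h3 := integral_add_left_eq_self (μ := volume)
    (fun y : V => tent (s⁻¹ • (y - x)) • u (radialProj y)) x
  simp only [add_sub_cancel_left] at h3
  have h4 : s ^ (m + 2) * (s ^ (m + 1))⁻¹ = s := by
    rw [pow_succ s (m + 1), mul_comm (s ^ (m + 1)), mul_inv_cancel_right₀ (by positivity)]
  rw [h2, h3, finrank_euclideanSpace_fin, abs_of_pos (by positivity), ← mul_smul, h4, coneAverage]
  simp only [h1, mul_smul]
  exact integral_smul _ _

lemma coneAverage_halfDepth (u : C(Sph m, W)) {x : V} (hx : ‖x‖ < 1) :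
    coneAverage u x (halfDepth x) =
      (halfDepth x ^ (m + 2) * tentMass m) • averageExtension u x := by
  rw [coneAverage_eq u x (halfDepth_pos hx), averageExtension, smul_smul, mul_assoc,
    mul_inv_cancel₀ tentMass_pos.ne', mul_one]

lemma integrable_coneAverage (u : C(Sph m, W)) (x : V) (s : ℝ) :
    Integrable fun y : V => max 0 (s - ‖y - x‖) • u (radialProj y) := by
  have hc : Continuous fun y : V => max 0 (s - ‖y - x‖) := by fun_prop
  have hs : HasCompactSupport fun y : V => max 0 (s - ‖y - x‖) :=
    HasCompactSupport.of_support_subset_isCompact (isCompact_closedBall x s) fun y hy => by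
      by_contra h
      rw [mem_closedBall, dist_eq_norm, not_le] at h
      exact hy (max_eq_left (by linarith))
  refine ((hc.integrable_of_hasCompactSupport hs).mul_const ‖u‖).mono'
    (hc.aestronglyMeasurable.smul (aestronglyMeasurable_comp_radialProj u continuous_id))
    (ae_of_all _ fun y => ?_)
  rw [norm_smul, Real.norm_of_nonneg (le_max_left _ _)]
  exact mul_le_mul_of_nonneg_left (u.norm_coe_le_norm _) (le_max_left _ _)

/-- The differences fall on the weight, which is 1-Lipschitz in the centre and in the radius, so
only the sup norm of `u` enters. Both weights are supported in the ball of radius r about x. -/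
lemma norm_coneAverage_sub_le (u : C(Sph m, W)) {x y : V} {s t r : ℝ} (hs : s ≤ r)
    (ht : ‖x - y‖ + t ≤ r) (hr : 0 ≤ r) :
    ‖coneAverage u x s - coneAverage u y t‖ ≤
      (|s - t| + ‖x - y‖) * ‖u‖ * (r ^ (m + 1) * volume.real (ball (0 : V) 1)) := by
  rw [coneAverage, coneAverage,
    ← integral_sub (integrable_coneAverage u x s) (integrable_coneAverage u y t)]
  simp only [← sub_smul]
  rw [← setIntegral_eq_integral_of_forall_compl_eq_zero (s := ball x r)]
  · have hv : volume.real (ball x r) = r ^ (m + 1) * volume.real (ball (0 : V) 1) := by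
      rw [measureReal_def, Measure.addHaar_ball _ _ hr, finrank_euclideanSpace_fin,
        ENNReal.toReal_mul, ENNReal.toReal_ofReal (by positivity), measureReal_def]
    rw [← hv]
    refine norm_setIntegral_le_of_norm_le_const measure_ball_lt_top fun z _ => ?_
    rw [norm_smul]
    refine mul_le_mul ?_ (u.norm_coe_le_norm _) (norm_nonneg _) (by positivity)
    rw [Real.norm_eq_abs]
    refine (abs_max_sub_max_le_max 0 _ 0 _).trans ?_
    rw [sub_self, abs_zero]
    refine max_le (by positivity) ?_
    have h1 : s - ‖z - x‖ - (t - ‖z - y‖) = (s - t) + (‖z - y‖ - ‖z - x‖) := by ring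
    rw [h1]
    refine (abs_add_le _ _).trans (add_le_add_right ?_ _)
    refine (abs_norm_sub_norm_le _ _).trans (le_of_eq ?_)
    rw [sub_sub_sub_cancel_left]
  · intro z hz
    rw [mem_ball, dist_eq_norm, not_lt] at hz
    have h1 := norm_sub_le_norm_sub_add_norm_sub z y x
    rw [norm_sub_rev y x] at h1
    rw [max_eq_left (by linarith), max_eq_left (by linarith), sub_self, zero_smul]

variable (m) in
/-- A Lipschitz constant of averages. -/
noncomputable def averageLipschitzConst : ℝ :=
  4 + 3 * (2 ^ (m + 1) * volume.real (ball (0 : V) 1)) / tentMass m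

lemma averageLipschitzConst_pos : 0 < averageLipschitzConst m := by
  have := tentMass_pos (m := m)
  unfold averageLipschitzConst
  positivity

/-- Averages are Lipschitz-continuous with respect to the hyperbolic distance. -/
lemma norm_averageExtension_sub_le (u : C(Sph m, W)) {x y : V} (hx : ‖x‖ < 1) (hy : ‖y‖ < 1) :
    ‖averageExtension u x - averageExtension u y‖ ≤
      averageLipschitzConst m * ‖u‖ * ‖x - y‖ / halfDepth x := by
  have hs := halfDepth_pos hx
  set s := halfDepth x with hs'
  set v := 2 ^ (m + 1) * volume.real (ball (0 : V) 1) with hv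
  have hτ := tentMass_pos (m := m)
  have hv0 : 0 ≤ v := by positivity
  rw [le_div_iff₀ hs, averageLipschitzConst, ← hv]
  -- For distant points the trivial bound 2‖u‖ suffices and yields the 4 in the constant. For close
  -- points both balls of averaging lie in the ball of radius 2s about x.
  rcases lt_or_ge (s / 2) ‖x - y‖ with h | h
  · have h1 : ‖averageExtension u x - averageExtension u y‖ ≤ 2 * ‖u‖ := by
      refine (norm_sub_le _ _).trans ?_
      linarith [norm_averageExtension_le u x, norm_averageExtension_le u y]
    have h2 : 0 ≤ 3 * v / tentMass m * ‖u‖ * ‖x - y‖ := by positivity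
    nlinarith [norm_nonneg u]
  · have hst := abs_halfDepth_sub_le x y
    rw [← hs'] at hst
    set t := halfDepth y with ht'
    have ht : ‖x - y‖ + t ≤ 2 * s := by
      have := (abs_le.1 hst).1
      linarith
    have e1 := coneAverage_halfDepth u hx
    have e2 := coneAverage_halfDepth u hy
    have d1 := norm_coneAverage_sub_le u (by linarith : s ≤ 2 * s) ht (by positivity)
    -- Applied to the constant 1, the same estimate compares the normalizing masses p and q of the
    -- two averages.
    have e3 := coneAverage_halfDepth (ContinuousMap.const (Sph m) (1 : ℝ)) hx
    have e4 := coneAverage_halfDepth (ContinuousMap.const (Sph m) (1 : ℝ)) hy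
    have d2 := norm_coneAverage_sub_le (ContinuousMap.const (Sph m) (1 : ℝ))
      (by linarith : s ≤ 2 * s) ht (by positivity)
    have hone : ∀ x : V, averageExtension (ContinuousMap.const (Sph m) (1 : ℝ)) x = 1 := by
      intro x
      simp only [averageExtension, ContinuousMap.const_apply, smul_eq_mul, mul_one]
      exact inv_mul_cancel₀ hτ.ne'
    have hn1 : ‖ContinuousMap.const (Sph m) (1 : ℝ)‖ ≤ 1 :=
      (ContinuousMap.norm_le _ zero_le_one).2 fun _ => by simp
    rw [hone, smul_eq_mul, mul_one] at e3 e4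
    rw [← hs'] at e1 e3
    rw [← ht'] at e2 e4
    rw [e1, e2] at d1
    rw [e3, e4] at d2
    rw [mul_pow, mul_right_comm _ (s ^ (m + 1)), ← hv] at d1 d2
    set p := s ^ (m + 2) * tentMass m with hp
    set q := t ^ (m + 2) * tentMass m with hq
    have hsum : |s - t| + ‖x - y‖ ≤ 3 / 2 * ‖x - y‖ := by linarith
    have hsv : 0 ≤ v * s ^ (m + 1) := by positivity
    have d1' : ‖p • averageExtension u x - q • averageExtension u y‖ ≤
        3 / 2 * ‖x - y‖ * ‖u‖ * (v * s ^ (m + 1)) :=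
      d1.trans (mul_le_mul_of_nonneg_right
        (mul_le_mul_of_nonneg_right hsum (norm_nonneg _)) hsv)
    have d2' : ‖p - q‖ ≤ 3 / 2 * ‖x - y‖ * (v * s ^ (m + 1)) := by
      refine d2.trans (mul_le_mul_of_nonneg_right ?_ hsv)
      refine (mul_le_mul hsum hn1 (norm_nonneg _) (by positivity)).trans (le_of_eq (mul_one _))
    have hp0 : 0 < p := by positivity
    have hmain : p * ‖averageExtension u x - averageExtension u y‖ ≤
        3 * ‖x - y‖ * ‖u‖ * (v * s ^ (m + 1)) := by
      rw [← Real.norm_of_nonneg hp0.le, ← norm_smul]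
      have : p • (averageExtension u x - averageExtension u y) =
          (p • averageExtension u x - q • averageExtension u y) -
            (p - q) • averageExtension u y := by
        module
      rw [this]
      refine (norm_sub_le _ _).trans ?_
      rw [norm_smul (p - q)]
      have := mul_le_mul d2' (norm_averageExtension_le u y) (norm_nonneg _) (by positivity)
      linarith
    have hsm : 0 < s ^ (m + 1) := by positivity
    have h5 : tentMass m * (‖averageExtension u x - averageExtension u y‖ * s) ≤
        3 * ‖x - y‖ * ‖u‖ * v := by
      refine le_of_mul_le_mul_right ?_ hsm
      rw [hp] at hmain
      linarith [hmain, pow_succ s (m + 1), show s ^ (m + 2) = s ^ (m + 1) * s from pow_succ s (m + 1),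
        show s ^ (m + 2) * tentMass m * ‖averageExtension u x - averageExtension u y‖ =
          tentMass m * (‖averageExtension u x - averageExtension u y‖ * s) * s ^ (m + 1) by ring]
    have h6 : ‖averageExtension u x - averageExtension u y‖ * s ≤
        3 * v / tentMass m * ‖u‖ * ‖x - y‖ := by
      rw [div_mul_eq_mul_div, div_mul_eq_mul_div, le_div_iff₀ hτ]
      linarith
    have h7 : 0 ≤ 4 * ‖u‖ * ‖x - y‖ := by positivity
    linarith

end Lipschitz

/-! ### Lower bound on the gap set near a bad point -/

section Polar

variable {m : ℕ}

local notation "V" => EuclideanSpace ℝ (Fin (m + 1))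
local notation "σ" => Measure.toSphere (volume : Measure V)

/-- The part of the sphere over which the average at `x` is taken. -/
def shadow (x : V) : Set (Sph m) := {η | ‖(η : V) - x‖ ≤ 4 * halfDepth x}

lemma measurableSet_shadow (x : V) : MeasurableSet (shadow x) :=
  (isClosed_le (by fun_prop) (by fun_prop)).measurableSet

/-- A ray meets the ball in a set of diameter at most twice its radius, and there t ≤ 1, so the
density t^k is at most 1. -/
lemma volumeIoiPow_le {x : V} (hx : ‖x‖ < 1) (η : Sph m) (k : ℕ) :
    Measure.volumeIoiPow k {t : Ioi (0 : ℝ) | ‖(t : ℝ) • (η : V) - x‖ < halfDepth x} ≤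
      ENNReal.ofReal (2 * halfDepth x) := by
  set B := {t : Ioi (0 : ℝ) | ‖(t : ℝ) • (η : V) - x‖ < halfDepth x} with hB
  have hBm : MeasurableSet B := (isOpen_lt (by fun_prop) (by fun_prop)).measurableSet
  have hlt : ∀ t ∈ B, (t : ℝ) ≤ 1 := by
    intro t ht
    have h1 : ‖(t : ℝ) • (η : V)‖ = t := by
      rw [norm_smul, norm_eq_of_mem_sphere, mul_one, Real.norm_of_nonneg (le_of_lt t.2)]
    have h2 := norm_sub_norm_le ((t : ℝ) • (η : V)) x
    have h3 : ‖(t : ℝ) • (η : V) - x‖ < halfDepth x := ht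
    rw [h1] at h2
    rw [halfDepth_of_lt hx] at h3
    linarith
  rw [Measure.volumeIoiPow, withDensity_apply _ hBm]
  calc ∫⁻ t in B, ENNReal.ofReal ((t : ℝ) ^ k) ∂Measure.comap Subtype.val volume
      ≤ ∫⁻ _ in B, 1 ∂Measure.comap Subtype.val volume := by
        refine setLIntegral_mono measurable_const fun t ht => ?_
        rw [← ENNReal.ofReal_one]
        exact ENNReal.ofReal_le_ofReal (pow_le_one₀ (le_of_lt t.2) (hlt t ht))
    _ = volume (Subtype.val '' B) := by
        rw [setLIntegral_const, one_mul, comap_subtype_coe_apply measurableSet_Ioi]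
    _ ≤ ediam (Subtype.val '' B) := Real.volume_le_diam _
    _ ≤ ENNReal.ofReal (2 * halfDepth x) := by
        refine ediam_le ?_
        rintro _ ⟨t, ht, rfl⟩ _ ⟨t', ht', rfl⟩
        rw [edist_dist]
        refine ENNReal.ofReal_le_ofReal ?_
        have h1 : dist (t : ℝ) t' = ‖((t : ℝ) • (η : V) - x) - ((t' : ℝ) • (η : V) - x)‖ := by
          rw [sub_sub_sub_cancel_right, ← sub_smul, norm_smul, norm_eq_of_mem_sphere, mul_one,
            Real.dist_eq, Real.norm_eq_abs]
        rw [h1]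
        refine (norm_sub_le _ _).trans ?_
        have h2 : ‖(t : ℝ) • (η : V) - x‖ < halfDepth x := ht
        have h3 : ‖(t' : ℝ) • (η : V) - x‖ < halfDepth x := ht'
        linarith

/-- Comparison between the volume and the surface measure in Whitney balls. -/
lemma volume_ball_inter_radialProj_le {x : V} (hx : ‖x‖ < 1) {S : Set (Sph m)}
    (hS : MeasurableSet S) :
    volume (ball x (halfDepth x) ∩ radialProj ⁻¹' S) ≤
      ENNReal.ofReal (2 * halfDepth x) * σ (S ∩ shadow x) := by
  set T : Set V := ball x (halfDepth x) ∩ radialProj ⁻¹' S with hT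
  set E : Set (Sph m × Ioi (0 : ℝ)) :=
    {p | p.1 ∈ S ∩ shadow x ∧ ‖(p.2 : ℝ) • (p.1 : V) - x‖ < halfDepth x} with hE
  have hEm : MeasurableSet E :=
    (measurable_fst (hS.inter (measurableSet_shadow x))).inter
      (isOpen_lt (f := fun p : Sph m × Ioi (0 : ℝ) => ‖(p.2 : ℝ) • (p.1 : V) - x‖)
        (by fun_prop) continuous_const).measurableSet
  have hsub : (Subtype.val ⁻¹' T : Set ({0}ᶜ : Set V)) ⊆ homeomorphUnitSphereProd V ⁻¹' E := by
    rintro ⟨y, hy0 : y ≠ 0⟩ ⟨hy1, hy2⟩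
    have hpos : 0 < ‖y‖ := norm_pos_iff.2 hy0
    have e1 : (homeomorphUnitSphereProd V ⟨y, hy0⟩).1 = radialProj y := by
      ext1
      rw [coe_radialProj hy0, homeomorphUnitSphereProd_apply_fst_coe]
    have e2 : ((homeomorphUnitSphereProd V ⟨y, hy0⟩).2 : ℝ) = ‖y‖ :=
      homeomorphUnitSphereProd_apply_snd_coe _ _
    have e3 : ‖y‖ • (radialProj y : V) = y := by
      rw [coe_radialProj hy0, smul_inv_smul₀ hpos.ne']
    change y ∈ ball x (halfDepth x) at hy1
    rw [mem_ball, dist_eq_norm] at hy1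
    refine ⟨⟨?_, ?_⟩, ?_⟩
    · rw [e1]
      exact hy2
    · rw [e1]
      change ‖(radialProj y : V) - x‖ ≤ 4 * halfDepth x
      have h1 : ‖(radialProj y : V) - y‖ = |1 - ‖y‖| := by
        conv_lhs => rw [← e3, radialProj_smul hpos]
        rw [show (radialProj y : V) - ‖y‖ • (radialProj y : V) =
          (1 - ‖y‖) • (radialProj y : V) by module, norm_smul, norm_eq_of_mem_sphere, mul_one,
          Real.norm_eq_abs]
      have h2 := norm_sub_le_norm_sub_add_norm_sub (radialProj y : V) y x
      have h3 := abs_le.1 (abs_norm_sub_norm_le y x)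
      have h4 := halfDepth_of_lt hx
      -- The depth of x is twice the radius, so that of y is at most three times; adding |y - x|
      -- explains the factor 4 in `shadow`.
      have h5 : |1 - ‖y‖| ≤ 3 * halfDepth x := abs_le.2 ⟨by linarith, by linarith⟩
      linarith
    · rw [e1, e2, e3]
      exact hy1
  have hmp := Measure.measurePreserving_homeomorphUnitSphereProd (volume : Measure V)
  rw [finrank_euclideanSpace_fin, Nat.add_sub_cancel] at hmp
  calc volume T = volume (T ∩ {0}ᶜ) := by
        exact (measure_inter_conull (by rw [compl_compl]; exact measure_singleton _)).symm
    _ = Measure.comap Subtype.val volume (Subtype.val ⁻¹' T : Set ({0}ᶜ : Set V)) := by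
        rw [comap_subtype_coe_apply (measurableSet_singleton _).compl,
          Subtype.image_preimage_coe, inter_comm]
    _ ≤ Measure.comap Subtype.val volume (homeomorphUnitSphereProd V ⁻¹' E) := measure_mono hsub
    _ = ((σ).prod (Measure.volumeIoiPow m)) E := hmp.measure_preimage hEm.nullMeasurableSet
    _ = ∫⁻ η, Measure.volumeIoiPow m (Prod.mk η ⁻¹' E) ∂σ := Measure.prod_apply hEm
    _ ≤ ∫⁻ η, (S ∩ shadow x).indicator (fun _ => ENNReal.ofReal (2 * halfDepth x)) η ∂σ := by
        refine lintegral_mono fun η => ?_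
        by_cases h : η ∈ S ∩ shadow x
        · rw [indicator_of_mem h]
          exact (measure_mono fun t ht => ht.2).trans (volumeIoiPow_le hx η m)
        · have : Prod.mk η ⁻¹' E = ∅ := eq_empty_of_forall_notMem fun t ht => h ht.1
          rw [this, measure_empty]
          exact zero_le
    _ = ENNReal.ofReal (2 * halfDepth x) * σ (S ∩ shadow x) :=
        lintegral_indicator_const (hS.inter (measurableSet_shadow x)) _

variable {W : Type*} [NormedAddCommGroup W] [NormedSpace ℝ W] [CompleteSpace W]

/-- If the average at `x` is far from a value `u η`, then `u` is far from `u η` on a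
substantial part of the shadow. -/
lemma le_volume_of_averageExtension_far (u : C(Sph m, W)) {D δ : ℝ} (hD : 0 < D)
    (hδ : 0 < δ) (huD : ∀ ξ η, ‖u ξ - u η‖ ≤ D) {x : V} (η : Sph m)
    (hfar : 2 * δ ≤ ‖averageExtension u x - u η‖) {S : Set (Sph m)} (hS : MeasurableSet S)
    (huS : ∀ ξ, ξ ∉ S → ‖u ξ - u η‖ ≤ δ) :
    ENNReal.ofReal (tentMass m * δ / D) ≤
      volume (ball (0 : V) 1 ∩ (fun z => radialProj (x + halfDepth x • z)) ⁻¹' S) := by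
  set T := ball (0 : V) 1 ∩ (fun z => radialProj (x + halfDepth x • z)) ⁻¹' S with hT
  have hTm : MeasurableSet T := measurableSet_ball.inter
    ((measurable_radialProj.comp (by fun_prop : Measurable fun z : V => x + halfDepth x • z)) hS)
  have hTfin : volume T ≠ ⊤ :=
    ((measure_mono inter_subset_left).trans_lt measure_ball_lt_top).ne
  have hτ := tentMass_pos (m := m)
  have hdiff : averageExtension u x - u η =
      (tentMass m)⁻¹ • ∫ z : V, tent z • (u (radialProj (x + halfDepth x • z)) - u η) := by
    have h1 : Integrable (fun z : V => tent z • u η) := integrable_tent.smul_const _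
    simp only [smul_sub]
    rw [integral_sub (integrable_tent_smul u (by fun_prop)) h1, smul_sub, averageExtension]
    congr 1
    rw [integral_smul_const, smul_smul]
    change _ = ((tentMass m)⁻¹ * tentMass m) • _
    rw [inv_mul_cancel₀ hτ.ne', one_smul]
  have hint : Integrable (fun z : V => tent z * δ + T.indicator (fun _ => D) z) :=
    (integrable_tent.mul_const δ).add ((integrable_indicator_iff hTm).2
      (integrableOn_const hTfin))
  -- The integrand is at most δ times the tent off `T`, with at most `D` more on `T`. A deviation of
  -- 2δ on average therefore leaves at least δ · `tentMass` to be paid by `T`.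
  have hle : ‖∫ z : V, tent z • (u (radialProj (x + halfDepth x • z)) - u η)‖ ≤
      ∫ z : V, (tent z * δ + T.indicator (fun _ => D) z) := by
    refine norm_integral_le_of_norm_le hint (ae_of_all _ fun z => ?_)
    rw [norm_smul, Real.norm_of_nonneg (tent_nonneg z)]
    rcases le_or_gt 1 ‖z‖ with hz | hz
    · rw [tent_eq_zero hz, zero_mul, zero_mul, zero_add]
      exact indicator_nonneg (fun _ _ => hD.le) _
    · by_cases hzS : radialProj (x + halfDepth x • z) ∈ S
      · have hzT : z ∈ T := ⟨mem_ball_zero_iff.2 hz, hzS⟩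
        rw [indicator_of_mem hzT]
        have h1 := mul_le_mul (tent_le_one z) (huD (radialProj (x + halfDepth x • z)) η)
          (norm_nonneg _) zero_le_one
        have h2 := mul_nonneg (tent_nonneg z) hδ.le
        linarith
      · have h1 := mul_le_mul_of_nonneg_left (huS _ hzS) (tent_nonneg z)
        have h2 : 0 ≤ T.indicator (fun _ => D) z := indicator_nonneg (fun _ _ => hD.le) _
        linarith
  rw [integral_add (integrable_tent.mul_const δ) ((integrable_indicator_iff hTm).2
      (integrableOn_const hTfin)), integral_mul_const, integral_indicator_const _ hTm,
      smul_eq_mul] at hle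
  change _ ≤ tentMass m * δ + volume.real T * D at hle
  rw [hdiff, norm_smul, norm_inv, Real.norm_of_nonneg hτ.le, le_inv_mul_iff₀ hτ] at hfar
  refine ENNReal.ofReal_le_of_le_toReal ?_
  change _ ≤ volume.real T
  rw [div_le_iff₀ hD]
  linarith

variable (m) in
/-- The constant in the lower bound on the gap measure near a bad point. -/
noncomputable def gapConst (δ D : ℝ) : ℝ := tentMass m * δ / (2 * D)

lemma gapConst_pos {δ D : ℝ} (hδ : 0 < δ) (hD : 0 < D) : 0 < gapConst m δ D := by
  have := tentMass_pos (m := m)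
  unfold gapConst
  positivity

/-- A fixed amount of z in the unit ball means volume of order s^{m+1} in the ball of averaging;
polar coordinates spend one factor s on the radial direction and leave s^m on the sphere. -/
lemma le_toSphere_of_averageExtension_far (u : C(Sph m, W)) {D δ : ℝ} (hD : 0 < D)
    (hδ : 0 < δ) (huD : ∀ ξ η, ‖u ξ - u η‖ ≤ D) {x : V} (hx : ‖x‖ < 1) (η : Sph m)
    (hfar : 2 * δ ≤ ‖averageExtension u x - u η‖) {S : Set (Sph m)} (hS : MeasurableSet S)
    (huS : ∀ ξ, ξ ∉ S → ‖u ξ - u η‖ ≤ δ) :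
    ENNReal.ofReal (gapConst m δ D * halfDepth x ^ m) ≤ σ (S ∩ shadow x) := by
  have hs := halfDepth_pos hx
  have h1 := le_volume_of_averageExtension_far u hD hδ huD η hfar hS huS
  have h2 := volume_ball_inter_radialProj_le hx hS
  set s := halfDepth x with hs'
  have h3 : volume (ball (0 : V) 1 ∩ (fun z => radialProj (x + s • z)) ⁻¹' S) =
      ENNReal.ofReal ((s ^ (m + 1))⁻¹) * volume (ball x s ∩ radialProj ⁻¹' S) := by
    have e1 : ball (0 : V) 1 ∩ (fun z => radialProj (x + s • z)) ⁻¹' S =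
        (s • ·) ⁻¹' ((x + ·) ⁻¹' (ball x s ∩ radialProj ⁻¹' S)) := by
      ext z
      simp only [mem_inter_iff, mem_preimage, mem_ball, dist_eq_norm, add_sub_cancel_left,
        norm_smul, Real.norm_of_nonneg hs.le, sub_zero]
      rw [mul_lt_iff_lt_one_right hs]
    rw [e1, Measure.addHaar_preimage_smul _ hs.ne', measure_preimage_add,
      finrank_euclideanSpace_fin, abs_of_pos (by positivity)]
  rw [h3] at h1
  have h4 := h1.trans (mul_le_mul_right h2 _)
  rw [← mul_assoc, ← ENNReal.ofReal_mul (by positivity)] at h4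
  set c := (s ^ (m + 1))⁻¹ * (2 * s) with hc
  have hc0 : 0 < c := by positivity
  have h5 : ENNReal.ofReal (gapConst m δ D * s ^ m) * ENNReal.ofReal c =
      ENNReal.ofReal (tentMass m * δ / D) := by
    rw [← ENNReal.ofReal_mul (mul_nonneg (gapConst_pos hδ hD).le (by positivity))]
    congr 1
    rw [hc, gapConst, pow_succ]
    field_simp
  rw [← h5, mul_comm] at h4
  exact (ENNReal.mul_le_mul_iff_right (ENNReal.ofReal_pos.2 hc0).ne' ENNReal.ofReal_ne_top).1 h4

/-- Near a point at which the average is far from the values of `u`, there is a substantial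
set of pairs of points at which `u` takes distant values. -/
lemma le_prod_toSphere_of_averageExtension_far (u : C(Sph m, W)) {D δ : ℝ} (hD : 0 < D)
    (hδ : 0 < δ) (huD : ∀ ξ η, ‖u ξ - u η‖ ≤ D) {x : V} (hx : ‖x‖ < 1)
    (hfar : ∀ η, 2 * δ ≤ ‖averageExtension u x - u η‖) {E : Set (Sph m × Sph m)}
    (hE : MeasurableSet E) (huE : ∀ ξ η, (η, ξ) ∉ E → ‖u ξ - u η‖ ≤ δ) :
    ENNReal.ofReal ((gapConst m δ D * halfDepth x ^ m) ^ 2) ≤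
      ((σ).prod σ) (E ∩ shadow x ×ˢ shadow x) := by
  have hA := measurableSet_shadow x
  set c := gapConst m δ D * halfDepth x ^ m with hc
  have hc0 : 0 ≤ c := mul_nonneg (gapConst_pos hδ hD).le (pow_nonneg (halfDepth_nonneg x) m)
  have hS : ∀ η, MeasurableSet (Prod.mk η ⁻¹' E) := fun η => measurable_prodMk_left hE
  have h1 : ∀ η, ENNReal.ofReal c ≤ σ (Prod.mk η ⁻¹' E ∩ shadow x) := fun η =>
    le_toSphere_of_averageExtension_far u hD hδ huD hx η (hfar η) (hS η)
      fun ξ hξ => huE ξ η hξ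
  -- The slice bound holds for every η, so any point, here `radialProj 0`, bounds the shadow itself
  -- from below; Fubini then squares the bound.
  have h2 : ENNReal.ofReal c ≤ σ (shadow x) :=
    (h1 (radialProj 0)).trans (measure_mono inter_subset_right)
  rw [Measure.prod_apply (hE.inter (hA.prod hA))]
  calc ENNReal.ofReal (c ^ 2) = ENNReal.ofReal c * ENNReal.ofReal c := by
        rw [← ENNReal.ofReal_mul hc0, pow_two]
    _ ≤ ENNReal.ofReal c * σ (shadow x) := mul_le_mul_right h2 _
    _ = ∫⁻ η, (shadow x).indicator (fun _ => ENNReal.ofReal c) η ∂σ :=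
        (lintegral_indicator_const hA _).symm
    _ ≤ _ := by
        refine lintegral_mono fun η => ?_
        by_cases h : η ∈ shadow x
        · rw [indicator_of_mem h]
          refine (h1 η).trans (measure_mono fun ξ hξ => ⟨hξ.1, h, hξ.2⟩)
        · rw [indicator_of_notMem h]
          exact zero_le

end Polar

/-! ### Counting separated bad points by the gap potential -/

section Counting

variable {m : ℕ}

local notation "V" => EuclideanSpace ℝ (Fin (m + 1))
local notation "σ" => Measure.toSphere (volume : Measure V)

lemma lintegral_comp_smul_sub (g : V → ℝ≥0∞) (hg : Measurable g) (a : V) {t : ℝ} (ht : 0 < t) :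
    ∫⁻ y : V, g (t⁻¹ • (y - a)) = ENNReal.ofReal (t ^ (m + 1)) * ∫⁻ y, g y := by
  rw [lintegral_sub_right_eq_self (fun y => g (t⁻¹ • y)) a]
  have h := Measure.map_addHaar_smul (volume : Measure V) (inv_ne_zero ht.ne')
  rw [finrank_euclideanSpace_fin, inv_pow, inv_inv, abs_of_pos (by positivity)] at h
  rw [← lintegral_map hg (by fun_prop : Measurable fun y : V => t⁻¹ • y), h,
    lintegral_smul_measure, smul_eq_mul]

variable (m) in
/-- An integrable decaying weight. -/
noncomputable def decay (y : V) : ℝ≥0∞ := ENNReal.ofReal ((1 + ‖y‖) ^ (-(3 * m + 1 : ℝ)))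

lemma measurable_decay : Measurable (decay m) := by
  unfold decay
  fun_prop

/-- The exponent 3m + 1 exceeds the dimension m + 1 because m ≥ 1. -/
lemma lintegral_decay_lt_top (hm : 1 ≤ m) : ∫⁻ y, decay m y < ⊤ := by
  refine finite_integral_one_add_norm ?_
  rw [finrank_euclideanSpace_fin]
  have : (1 : ℝ) ≤ m := by exact_mod_cast hm
  push_cast
  linarith

/-- Hyperbolically separated points have disjoint Whitney balls. -/
lemma disjoint_ball_of_separated {x y : V} (hx : ‖x‖ < 1) (hy : ‖y‖ < 1)
    (h : (1 - ‖x‖ ^ 2) * (1 - ‖y‖ ^ 2) < ‖x - y‖ ^ 2) :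
    Disjoint (ball x (halfDepth x / 4)) (ball y (halfDepth y / 4)) := by
  refine Set.disjoint_left.2 fun z hz hz' => ?_
  rw [mem_ball, dist_eq_norm] at hz hz'
  have h1 := norm_sub_le_norm_sub_add_norm_sub x z y
  rw [norm_sub_rev x z] at h1
  have h2 := abs_le.1 (abs_halfDepth_sub_le x y)
  have hs := halfDepth_pos hx
  have ht := halfDepth_pos hy
  have e1 := halfDepth_of_lt hx
  have e2 := halfDepth_of_lt hy
  set s := halfDepth x
  set t := halfDepth y
  -- A common point makes s and t comparable, and then |x - y|² is too small compared with s t for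
  -- the points to be separated.
  have h3 : ‖x - y‖ < (s + t) / 4 := by linarith
  have h4 : 2 * s ≤ 1 - ‖x‖ ^ 2 := by nlinarith [norm_nonneg x]
  have h5 : 2 * t ≤ 1 - ‖y‖ ^ 2 := by nlinarith [norm_nonneg y]
  have h6 : 4 * (s * t) ≤ (1 - ‖x‖ ^ 2) * (1 - ‖y‖ ^ 2) := by
    have := mul_le_mul h4 h5 (by positivity) (by linarith)
    linarith
  have h7 : ‖x - y‖ ^ 2 ≤ ((s + t) / 4) ^ 2 := pow_le_pow_left₀ (norm_nonneg _) h3.le 2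
  have h8 : (s - t) ^ 2 ≤ ((s + t) / 8) ^ 2 := sq_le_sq' (by linarith) (by linarith)
  nlinarith

variable (m) in
/-- The constant in the overlap bound for shadows. -/
noncomputable def overlapConst : ℝ :=
  13 ^ (3 * m + 1) * 4 ^ (m + 1) * (∫⁻ y, decay m y).toReal / volume.real (ball (0 : V) 1)

lemma overlapConst_nonneg : 0 ≤ overlapConst m := by
  unfold overlapConst
  positivity

/-- The shadows of hyperbolically separated points have controlled weighted overlap. -/
lemma sum_overlap_le (hm : 1 ≤ m) (s : Finset V) (hs : ∀ x ∈ s, ‖x‖ < 1)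
    (hsep : ∀ x ∈ s, ∀ y ∈ s, x ≠ y → (1 - ‖x‖ ^ 2) * (1 - ‖y‖ ^ 2) < ‖x - y‖ ^ 2)
    {η ξ : Sph m} (hne : η ≠ ξ) (hη : ∀ x ∈ s, η ∈ shadow x) (hξ : ∀ x ∈ s, ξ ∈ shadow x) :
    ∑ x ∈ s, (halfDepth x ^ (2 * m))⁻¹ ≤ overlapConst m * (1 / dist ξ η ^ (2 * m)) := by
  have ht : 0 < dist ξ η := dist_pos.2 hne.symm
  set t := dist ξ η with ht'
  have htn : t = ‖(ξ : V) - (η : V)‖ := by rw [ht', Subtype.dist_eq, dist_eq_norm]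
  set v := volume.real (ball (0 : V) 1) with hv
  have hv0 : 0 < v := ENNReal.toReal_pos (measure_ball_pos _ _ one_pos).ne' measure_ball_lt_top.ne
  set Q := ∫⁻ y, decay m y with hQ
  have hQfin : Q ≠ ⊤ := (lintegral_decay_lt_top hm).ne
  have hdis : (s : Set V).PairwiseDisjoint fun x => ball x (halfDepth x / 4) :=
    fun x hx y hy hxy => disjoint_ball_of_separated (hs x hx) (hs y hy) (hsep x hx y hy hxy)
  -- Write r^{-2m} = r^{-(3m+1)} r^{m+1}, the last factor being a ball volume up to a constant. On
  -- that ball |y - η| ≤ 5r, and t ≤ 8r, whence 13. As the balls are disjoint, the sum is dominated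
  -- by one convergent integral.
  have hone : ∀ x ∈ s, ENNReal.ofReal
      (t ^ (3 * m + 1) * v / (13 ^ (3 * m + 1) * 4 ^ (m + 1)) * (halfDepth x ^ (2 * m))⁻¹) ≤
      ∫⁻ y in ball x (halfDepth x / 4), decay m (t⁻¹ • (y - (η : V))) := by
    intro x hx
    have hr := halfDepth_pos (hs x hx)
    have h1 : ‖(η : V) - x‖ ≤ 4 * halfDepth x := hη x hx
    have h2 : ‖(ξ : V) - x‖ ≤ 4 * halfDepth x := hξ x hx
    set r := halfDepth x with hr'
    have h3 : t ≤ 8 * r := by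
      have := norm_sub_le ((ξ : V) - x) ((η : V) - x)
      rw [sub_sub_sub_cancel_right, ← htn] at this
      linarith
    have hvol : volume (ball x (r / 4)) = ENNReal.ofReal ((r / 4) ^ (m + 1) * v) := by
      rw [Measure.addHaar_ball _ _ (by positivity), finrank_euclideanSpace_fin, hv, measureReal_def,
        ENNReal.ofReal_mul (by positivity), ENNReal.ofReal_toReal measure_ball_lt_top.ne]
    calc _ = ENNReal.ofReal ((t / (13 * r)) ^ (3 * m + 1)) * volume (ball x (r / 4)) := by
          rw [hvol, ← ENNReal.ofReal_mul (by positivity)]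
          congr 1
          rw [div_pow, div_pow, mul_pow,
            show r ^ (3 * m + 1) = r ^ (2 * m) * r ^ (m + 1) by rw [← pow_add]; congr 1; ring]
          field_simp
      _ = ∫⁻ _ in ball x (r / 4), ENNReal.ofReal ((t / (13 * r)) ^ (3 * m + 1)) := by
          rw [setLIntegral_const]
      _ ≤ _ := by
          refine setLIntegral_mono
            (measurable_decay.comp (by fun_prop : Measurable fun y : V => t⁻¹ • (y - (η : V))))
            fun y hy => ENNReal.ofReal_le_ofReal ?_
          rw [mem_ball, dist_eq_norm] at hy
          have h4 : ‖y - (η : V)‖ ≤ 5 * r := by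
            have := norm_sub_le_norm_sub_add_norm_sub y x (η : V)
            rw [norm_sub_rev x] at this
            linarith
          have h5 : 1 + ‖t⁻¹ • (y - (η : V))‖ ≤ (13 * r) / t := by
            rw [norm_smul, norm_inv, Real.norm_of_nonneg ht.le, le_div_iff₀ ht, add_mul,
              mul_right_comm, inv_mul_cancel₀ ht.ne']
            linarith
          have h6 : (0 : ℝ) < 1 + ‖t⁻¹ • (y - (η : V))‖ := by positivity
          rw [Real.rpow_neg h6.le, show (3 * m + 1 : ℝ) = ((3 * m + 1 : ℕ) : ℝ) by push_cast; ring,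
            Real.rpow_natCast, ← inv_div (13 * r) t, inv_pow]
          exact inv_anti₀ (by positivity) (pow_le_pow_left₀ h6.le h5 _)
  have hsum := Finset.sum_le_sum hone
  rw [← lintegral_biUnion_finset hdis fun _ _ => measurableSet_ball] at hsum
  have h2 := hsum.trans (setLIntegral_le_lintegral _ _)
  rw [lintegral_comp_smul_sub _ measurable_decay _ ht, ← hQ, ← ENNReal.ofReal_sum_of_nonneg
    fun x _ => mul_nonneg (by positivity) (inv_nonneg.2 (pow_nonneg (halfDepth_nonneg x) _)),
    ← Finset.mul_sum, ← ENNReal.ofReal_toReal hQfin, ← ENNReal.ofReal_mul (by positivity),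
    ENNReal.ofReal_le_ofReal_iff (by positivity)] at h2
  rw [overlapConst, ← hv, ← hQ]
  have h3 : t ^ (3 * m + 1) = t ^ (2 * m) * t ^ (m + 1) := by
    rw [← pow_add]
    congr 1
    ring
  have h4 : 0 < t ^ (m + 1) := by positivity
  rw [h3] at h2
  have h5 : t ^ (2 * m) * v / (13 ^ (3 * m + 1) * 4 ^ (m + 1)) *
      ∑ x ∈ s, (halfDepth x ^ (2 * m))⁻¹ ≤ Q.toReal := by
    refine le_of_mul_le_mul_left (le_trans (le_of_eq ?_) h2) h4
    ring
  have h6 : (0 : ℝ) < t ^ (2 * m) := by positivity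
  rw [div_mul_div_comm, mul_one, le_div_iff₀ (by positivity)]
  rw [div_mul_eq_mul_div, div_le_iff₀ (by positivity)] at h5
  linarith

variable {W : Type*} [NormedAddCommGroup W] [NormedSpace ℝ W] [CompleteSpace W]

/-- The number of hyperbolically separated bad points is controlled by the gap potential. -/
lemma card_le_of_separated (hm : 1 ≤ m) (u : C(Sph m, W)) {D δ l : ℝ} (hD : 0 < D) (hl : 0 ≤ l)
    (hδ : 0 < δ) (huD : ∀ ξ η, ‖u ξ - u η‖ ≤ D) {E : Set (Sph m × Sph m)}
    (hE : MeasurableSet E) (huE : ∀ ξ η, (η, ξ) ∉ E → ‖u ξ - u η‖ ≤ δ)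
    (hdiag : ∀ η, (η, η) ∉ E)
    (hgap : ∫⁻ p in E, ENNReal.ofReal (1 / dist p.2 p.1 ^ (2 * m)) ∂((σ).prod σ) ≤
      ENNReal.ofReal l)
    (s : Finset V) (hs : ∀ x ∈ s, ‖x‖ < 1)
    (hfar : ∀ x ∈ s, ∀ η, 2 * δ ≤ ‖averageExtension u x - u η‖)
    (hsep : ∀ x ∈ s, ∀ y ∈ s, x ≠ y → (1 - ‖x‖ ^ 2) * (1 - ‖y‖ ^ 2) < ‖x - y‖ ^ 2) :
    (s.card : ℝ) ≤ overlapConst m / gapConst m δ D ^ 2 * l := by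
  classical
  have hc := gapConst_pos (m := m) hδ hD
  set c := gapConst m δ D with hc'
  have hA : ∀ x : V, MeasurableSet (shadow x ×ˢ shadow x) := fun x =>
    (measurableSet_shadow x).prod (measurableSet_shadow x)
  -- The weight r^{-2m} makes every bad point contribute at least c² to the integral over `E`,
  -- whatever its depth.
  have h1 : ∀ x ∈ s, ENNReal.ofReal (c ^ 2) ≤
      ∫⁻ p in E, (shadow x ×ˢ shadow x).indicator
        (fun _ => ENNReal.ofReal (halfDepth x ^ (2 * m))⁻¹) p ∂((σ).prod σ) := by
    intro x hx
    have hr := halfDepth_pos (hs x hx)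
    rw [lintegral_indicator_const (hA x), Measure.restrict_apply (hA x), inter_comm]
    refine le_trans (le_of_eq ?_) (mul_le_mul_right
      (le_prod_toSphere_of_averageExtension_far u hD hδ huD (hs x hx) (hfar x hx) hE huE) _)
    rw [← ENNReal.ofReal_mul (by positivity), ← hc']
    congr 1
    rw [mul_pow, ← pow_mul, mul_comm m 2]
    field_simp
  have h2 := Finset.sum_le_sum h1
  rw [← lintegral_finsetSum _ fun x _ => measurable_const.indicator (hA x)] at h2
  have h3 : ∫⁻ p in E, ∑ x ∈ s, (shadow x ×ˢ shadow x).indicator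
        (fun _ => ENNReal.ofReal (halfDepth x ^ (2 * m))⁻¹) p ∂((σ).prod σ) ≤
      ∫⁻ p in E, ENNReal.ofReal (overlapConst m) *
        ENNReal.ofReal (1 / dist p.2 p.1 ^ (2 * m)) ∂((σ).prod σ) := by
    refine setLIntegral_mono (by fun_prop) fun p hp => ?_
    -- On the diagonal the kernel is 1 / 0 = 0 and bounds nothing, so the diagonal has to lie
    -- outside `E`.
    have hne : p.1 ≠ p.2 := by
      rintro h
      refine hdiag p.1 ?_
      conv in (p.1, p.1) => rw [show (p.1, p.1) = p from Prod.ext rfl h]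
      exact hp
    have h4 := sum_overlap_le hm (s.filter fun x => p ∈ shadow x ×ˢ shadow x)
      (fun x hx => hs x (Finset.mem_filter.1 hx).1)
      (fun x hx y hy => hsep x (Finset.mem_filter.1 hx).1 y (Finset.mem_filter.1 hy).1) hne
      (fun x hx => (Finset.mem_filter.1 hx).2.1) (fun x hx => (Finset.mem_filter.1 hx).2.2)
    rw [← ENNReal.ofReal_mul overlapConst_nonneg]
    refine le_trans (le_of_eq ?_) (ENNReal.ofReal_le_ofReal h4)
    rw [ENNReal.ofReal_sum_of_nonneg fun x _ => inv_nonneg.2 (pow_nonneg (halfDepth_nonneg x) _),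
      Finset.sum_filter]
    exact Finset.sum_congr rfl fun x _ => by simp only [indicator]
  have h4 := h2.trans h3
  rw [lintegral_const_mul _ (by fun_prop)] at h4
  have h5 := h4.trans (mul_le_mul_right hgap _)
  rw [Finset.sum_const, nsmul_eq_mul, ← ENNReal.ofReal_natCast,
    ← ENNReal.ofReal_mul (by positivity), ← ENNReal.ofReal_mul overlapConst_nonneg,
    ENNReal.ofReal_le_ofReal_iff (mul_nonneg overlapConst_nonneg hl)] at h5
  rw [div_mul_eq_mul_div, le_div_iff₀ (by positivity)]
  exact h5

end Counting

/-! ### Hyperbolic balls, merging and maximal separated sets -/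

section Hyperbolic

variable {m : ℕ}

local notation "V" => EuclideanSpace ℝ (Fin (m + 1))

/-- Points of the unit ball are at bounded hyperbolic distance, in terms of a parameter `K`. -/
def HypNear (K : ℝ) (x y : V) : Prop := ‖x - y‖ ^ 2 ≤ K * ((1 - ‖x‖ ^ 2) * (1 - ‖y‖ ^ 2))

/-- The Euclidean centre of a hyperbolic ball. -/
noncomputable def hypCenter (K : ℝ) (x : V) : V := (1 + K * (1 - ‖x‖ ^ 2))⁻¹ • x

/-- The Euclidean radius of a hyperbolic ball. -/
noncomputable def hypRadius (K : ℝ) (x : V) : ℝ :=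
  (1 - ‖x‖ ^ 2) * √(K * (K + 1)) / (1 + K * (1 - ‖x‖ ^ 2))

lemma one_sub_sq_pos {x : V} (hx : ‖x‖ < 1) : 0 < 1 - ‖x‖ ^ 2 := by
  nlinarith [norm_nonneg x]

lemma HypNear.symm {K : ℝ} {x y : V} (h : HypNear K x y) : HypNear K y x := by
  rwa [HypNear, norm_sub_rev, mul_comm (1 - ‖y‖ ^ 2)]

lemma HypNear.mono {K K' : ℝ} (hK : K ≤ K') {x y : V} (hx : ‖x‖ < 1) (hy : ‖y‖ < 1)
    (h : HypNear K x y) : HypNear K' x y :=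
  h.trans (mul_le_mul_of_nonneg_right hK (mul_pos (one_sub_sq_pos hx) (one_sub_sq_pos hy)).le)

/-- With a and b the two factors, (a - b)² ≤ 4|x - y|² ≤ 4Kab; expanding and dropping b² gives a² ≤
(4K + 2)ab. -/
lemma HypNear.comparable {K : ℝ} {x y : V} (hx : ‖x‖ < 1) (hy : ‖y‖ < 1)
    (h : HypNear K x y) : 1 - ‖x‖ ^ 2 ≤ (4 * K + 2) * (1 - ‖y‖ ^ 2) := by
  have ha := one_sub_sq_pos hx
  have hb := one_sub_sq_pos hy
  have h1 : |‖x‖ - ‖y‖| ≤ ‖x - y‖ := abs_norm_sub_norm_le x y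
  have h2 : ((1 - ‖x‖ ^ 2) - (1 - ‖y‖ ^ 2)) ^ 2 ≤ 4 * ‖x - y‖ ^ 2 := by
    have h3 : (‖x‖ - ‖y‖) ^ 2 ≤ ‖x - y‖ ^ 2 := sq_le_sq' (abs_le.1 h1).1 (abs_le.1 h1).2
    have h4 : (‖x‖ + ‖y‖) ^ 2 ≤ 4 := by nlinarith [norm_nonneg x, norm_nonneg y]
    have h5 : ((1 - ‖x‖ ^ 2) - (1 - ‖y‖ ^ 2)) ^ 2 = (‖x‖ + ‖y‖) ^ 2 * (‖x‖ - ‖y‖) ^ 2 := by ring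
    rw [h5]
    exact mul_le_mul h4 h3 (sq_nonneg _) (by norm_num)
  unfold HypNear at h
  set a := 1 - ‖x‖ ^ 2
  set b := 1 - ‖y‖ ^ 2
  refine le_of_mul_le_mul_left ?_ ha
  nlinarith

/-- The change of parameter in the triangle inequality. -/
def hypDouble (K : ℝ) : ℝ := 4 * K * (4 * K + 2)

lemma le_hypDouble {K : ℝ} (hK : 0 < K) : K ≤ hypDouble K := by
  unfold hypDouble
  nlinarith

/-- The Euclidean triangle inequality, squared, bounds |x - z|² by 2K(ab + bc); comparability
replaces the middle factor b by a multiple of c or of a. -/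
lemma HypNear.trans {K : ℝ} (hK : 0 < K) {x y z : V} (hx : ‖x‖ < 1) (hy : ‖y‖ < 1)
    (hz : ‖z‖ < 1) (h : HypNear K x y) (h' : HypNear K y z) : HypNear (hypDouble K) x z := by
  have ha := one_sub_sq_pos hx
  have hb := one_sub_sq_pos hy
  have hc := one_sub_sq_pos hz
  have h1 := h'.comparable hy hz
  have h2 := h.symm.comparable hy hx
  have h3 : ‖x - z‖ ^ 2 ≤ 2 * ‖x - y‖ ^ 2 + 2 * ‖y - z‖ ^ 2 := by
    have := norm_sub_le_norm_sub_add_norm_sub x y z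
    nlinarith [norm_nonneg (x - z), sq_nonneg (‖x - y‖ - ‖y - z‖)]
  unfold HypNear hypDouble at *
  set a := 1 - ‖x‖ ^ 2
  set b := 1 - ‖y‖ ^ 2
  set c := 1 - ‖z‖ ^ 2
  have h4 : K * (a * b) ≤ K * (a * ((4 * K + 2) * c)) := by gcongr
  have h5 : K * (b * c) ≤ K * ((4 * K + 2) * a * c) := by gcongr
  linarith

/-- Completing the square in y shows that hyperbolic balls are Euclidean balls; this is what
dictates the centre and the radius. -/
lemma sq_norm_sub_hypCenter {K : ℝ} (hK : 0 < K) {x : V} (hx : ‖x‖ < 1) (y : V) :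
    (1 + K * (1 - ‖x‖ ^ 2)) * (‖y - hypCenter K x‖ ^ 2 - hypRadius K x ^ 2) =
      ‖x - y‖ ^ 2 - K * ((1 - ‖x‖ ^ 2) * (1 - ‖y‖ ^ 2)) := by
  have ha := one_sub_sq_pos hx
  have h1 : 0 < 1 + K * (1 - ‖x‖ ^ 2) := by positivity
  rw [hypRadius, hypCenter, div_pow, mul_pow, Real.sq_sqrt (by positivity), norm_sub_sq_real,
    norm_sub_sq_real, inner_smul_right, norm_smul, norm_inv, Real.norm_of_nonneg h1.le,
    real_inner_comm]
  field_simp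
  ring

lemma hypRadius_pos {K : ℝ} (hK : 0 < K) {x : V} (hx : ‖x‖ < 1) : 0 < hypRadius K x := by
  have ha := one_sub_sq_pos hx
  unfold hypRadius
  positivity

lemma mem_closedBall_hyp_iff {K : ℝ} (hK : 0 < K) {x : V} (hx : ‖x‖ < 1) {y : V} :
    y ∈ closedBall (hypCenter K x) (hypRadius K x) ↔ HypNear K x y := by
  have ha := one_sub_sq_pos hx
  have h1 : 0 < 1 + K * (1 - ‖x‖ ^ 2) := by positivity
  have h2 := sq_norm_sub_hypCenter hK hx y
  rw [mem_closedBall, dist_eq_norm, HypNear,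
    ← sq_le_sq₀ (norm_nonneg _) (hypRadius_pos hK hx).le, ← sub_nonpos,
    ← sub_nonpos (a := ‖x - y‖ ^ 2), ← h2]
  exact ⟨fun h => mul_nonpos_of_nonneg_of_nonpos h1.le h,
    fun h => nonpos_of_mul_nonpos_right h h1⟩

lemma mem_ball_hyp {K K' : ℝ} (hK : K' < K) (hK0 : 0 < K) {x y : V} (hx : ‖x‖ < 1)
    (hy : ‖y‖ < 1) (h : HypNear K' x y) : y ∈ ball (hypCenter K x) (hypRadius K x) := by
  have ha := one_sub_sq_pos hx
  have hb := one_sub_sq_pos hy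
  have h1 : 0 < 1 + K * (1 - ‖x‖ ^ 2) := by positivity
  rw [mem_ball, dist_eq_norm, ← sq_lt_sq₀ (norm_nonneg _) (hypRadius_pos hK0 hx).le]
  have h2 := sq_norm_sub_hypCenter hK0 hx y
  have h3 : K' * ((1 - ‖x‖ ^ 2) * (1 - ‖y‖ ^ 2)) < K * ((1 - ‖x‖ ^ 2) * (1 - ‖y‖ ^ 2)) :=
    mul_lt_mul_of_pos_right hK (mul_pos ha hb)
  unfold HypNear at h
  by_contra hle
  have := mul_nonneg h1.le (sub_nonneg.2 (not_lt.1 hle))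
  linarith

lemma HypNear.norm_lt_one {K : ℝ} (hK : 0 < K) {x y : V} (hx : ‖x‖ < 1) (h : HypNear K x y) :
    ‖y‖ < 1 := by
  have ha := one_sub_sq_pos hx
  by_contra hy
  have hy := not_lt.1 hy
  have h1 : K * ((1 - ‖x‖ ^ 2) * (1 - ‖y‖ ^ 2)) ≤ 0 :=
    mul_nonpos_of_nonneg_of_nonpos hK.le
      (mul_nonpos_of_nonneg_of_nonpos ha.le (by nlinarith))
  have h2 : ‖x - y‖ ^ 2 ≤ 0 := le_trans h h1
  have h3 : x = y := by
    rw [← sub_eq_zero, ← norm_eq_zero]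
    exact pow_eq_zero_iff two_ne_zero |>.1 (le_antisymm h2 (sq_nonneg _))
  rw [h3] at hx
  linarith

/-- Rescaling a hyperbolic ball to unit size costs its radius, while the Lipschitz estimate for
averages gains the inverse depth; their ratio depends on K only. -/
lemma hypRadius_le_halfDepth {K : ℝ} (hK : 0 < K) {x y : V} (hx : ‖x‖ < 1) (h : HypNear K x y) :
    hypRadius K x ≤ 4 * (K + 1) * (4 * K + 2) * halfDepth y := by
  have hy := h.norm_lt_one hK hx
  have ha := one_sub_sq_pos hx
  have h1 := h.comparable hx hy
  have h2 : √(K * (K + 1)) ≤ K + 1 := by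
    rw [Real.sqrt_le_left (by positivity)]
    nlinarith
  have h3 : hypRadius K x ≤ (1 - ‖x‖ ^ 2) * (K + 1) := by
    unfold hypRadius
    refine (div_le_self (by positivity) (by nlinarith [mul_pos hK ha])).trans ?_
    gcongr
  have h4 : 1 - ‖y‖ ^ 2 ≤ 4 * halfDepth y := by
    rw [halfDepth_of_lt hy]
    nlinarith [norm_nonneg y]
  calc hypRadius K x ≤ (1 - ‖x‖ ^ 2) * (K + 1) := h3
    _ ≤ ((4 * K + 2) * (1 - ‖y‖ ^ 2)) * (K + 1) := by gcongr
    _ ≤ ((4 * K + 2) * (4 * halfDepth y)) * (K + 1) := by gcongr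
    _ = _ := by ring

/-- Hyperbolic balls can be merged into disjoint ones. -/
lemma exists_merge (n : ℕ) : ∀ K : ℝ, 0 < K → ∃ Kmax : ℝ, ∀ s : Finset V, s.card ≤ n →
    (∀ x ∈ s, ‖x‖ < 1) → ∃ t ⊆ s, ∃ K' : ℝ, K ≤ K' ∧ K' ≤ Kmax ∧
      (∀ x ∈ s, ∀ y : V, HypNear K x y → ∃ x' ∈ t, HypNear K' x' y) ∧
      ∀ x ∈ t, ∀ y ∈ t, x ≠ y → ¬ HypNear (hypDouble (2 * K')) x y := by
  classical
  induction n with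
  | zero =>
    refine fun K hK => ⟨K, fun s hs _ => ⟨s, subset_rfl, K, le_rfl, le_rfl,
      fun x hx y h => ⟨x, hx, h⟩, ?_⟩⟩
    simp [Finset.card_eq_zero.1 (Nat.le_zero.1 hs)]
  | succ n ih =>
    intro K hK
    -- By `HypNear.trans`, centres that are not K₁-near have disjoint balls of parameter 2K.
    set K₁ := hypDouble (2 * K) with hK₁
    have h2K : 2 * K ≤ K₁ := le_hypDouble (by positivity)
    have hK₁0 : 0 < K₁ := by linarith
    have hK₂ : K₁ ≤ hypDouble K₁ := le_hypDouble hK₁0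
    -- When two centres are K₁-near, one is dropped and the ball of the other, with parameter
    -- `hypDouble K₁`, swallows both. Each merge lowers the cardinality, so the final parameter is
    -- bounded in terms of n and K alone.
    obtain ⟨Kmax, hmax⟩ := ih (hypDouble K₁) (by linarith)
    refine ⟨max K Kmax, fun s hs hs1 => ?_⟩
    by_cases hsep : ∀ x ∈ s, ∀ y ∈ s, x ≠ y → ¬ HypNear K₁ x y
    · exact ⟨s, subset_rfl, K, le_rfl, le_max_left _ _, fun x hx y h => ⟨x, hx, h⟩, hsep⟩
    · push Not at hsep
      obtain ⟨x, hx, y, hy, hxy, hnear⟩ := hsep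
      obtain ⟨t, ht, K', h1, h2, h3, h4⟩ := hmax (s.erase y)
        (by rw [Finset.card_erase_of_mem hy]; omega)
        (fun z hz => hs1 z (Finset.mem_of_mem_erase hz))
      refine ⟨t, ht.trans (Finset.erase_subset _ _), K', by linarith,
        h2.trans (le_max_right _ _), fun z hz w hzw => ?_, h4⟩
      have hw := hzw.norm_lt_one hK (hs1 z hz)
      by_cases hzy : z = y
      · subst hzy
        refine h3 x (Finset.mem_erase.2 ⟨hxy, hx⟩) w ?_
        exact hnear.trans hK₁0 (hs1 x hx) (hs1 z hz) hw
          (hzw.mono (by linarith) (hs1 z hz) hw)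
      · exact h3 z (Finset.mem_erase.2 ⟨hzy, hz⟩) w (hzw.mono (by linarith) (hs1 z hz) hw)

/-- A maximal separated subset exists as soon as separated subsets have bounded cardinality. -/
lemma exists_maximal_separated {α : Type*} (P : Set α) (r : α → α → Prop)
    (hr : ∀ x y, r x y → r y x) (n : ℕ)
    (hn : ∀ s : Finset α, ↑s ⊆ P → (∀ x ∈ s, ∀ y ∈ s, x ≠ y → r x y) → s.card ≤ n) :
    ∃ s : Finset α, ↑s ⊆ P ∧ (∀ x ∈ s, ∀ y ∈ s, x ≠ y → r x y) ∧
      ∀ y ∈ P, ∃ x ∈ s, x = y ∨ ¬ r x y := by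
  classical
  set S : Set ℕ := {k | ∃ s : Finset α, ↑s ⊆ P ∧ (∀ x ∈ s, ∀ y ∈ s, x ≠ y → r x y) ∧
    s.card = k} with hS
  have hb : BddAbove S := ⟨n, fun k ⟨s, h1, h2, h3⟩ => h3 ▸ hn s h1 h2⟩
  obtain ⟨s, h1, h2, h3⟩ : sSup S ∈ S := Nat.sSup_mem ⟨0, ∅, by simp, by simp, rfl⟩ hb
  refine ⟨s, h1, h2, fun y hy => ?_⟩
  by_contra hcon
  push Not at hcon
  have hys : y ∉ s := fun h => (hcon y h).1 rfl
  have hmem : s.card + 1 ∈ S := by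
    refine ⟨insert y s, ?_, ?_, Finset.card_insert_of_notMem hys⟩
    · rw [Finset.coe_insert]
      exact insert_subset hy h1
    · intro x hx z hz hxz
      rcases Finset.mem_insert.1 hx with rfl | hx' <;> rcases Finset.mem_insert.1 hz with rfl | hz'
      · exact absurd rfl hxz
      · exact hr _ _ (hcon z hz').2
      · exact (hcon x hx').2
      · exact h2 x hx' z hz' hxz
  have := le_csSup hb hmem
  omega

end Hyperbolic

/-! ### Finitely many homotopy classes from equicontinuity -/

section Finiteness

variable {m : ℕ}

/-- Retractions of equi-Lipschitz maps fall into finitely many homotopy classes. -/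
lemma exists_finite_homotopy_classes {N W : Type*} [TopologicalSpace N] [Nonempty N]
    [NormedAddCommGroup W] [NormedSpace ℝ W] [FiniteDimensional ℝ W] {X : Set W} (hX : IsCompact X)
    (hXne : X.Nonempty) {δ : ℝ} (hδ : 0 < δ) {r : W → N}
    (hr : ContinuousOn r {y | infDist y X < 3 * δ}) (L : NNReal) :
    ∃ F : Set C(Sph m, N), F.Finite ∧ ∀ (v : C(Sph m, W)) (b : C(Sph m, N)),
      (∀ ξ, infDist (v ξ) X ≤ 2 * δ) → LipschitzWith L v → (∀ ξ, r (v ξ) = b ξ) →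
      ∃ w ∈ F, b.Homotopic w := by
  classical
  set A : Set (BoundedContinuousFunction (Sph m) W) :=
    {v | (∀ ξ, infDist (v ξ) X ≤ 2 * δ) ∧ LipschitzWith L v} with hA
  have hcpt : IsCompact {y : W | infDist y X ≤ 2 * δ} := by
    have := FiniteDimensional.proper ℝ W
    convert hX.cthickening (r := 2 * δ) using 1
    ext y
    rw [mem_cthickening_iff,
      ENNReal.le_ofReal_iff_toReal_le (infEDist_ne_top hXne) (by positivity)]
    rfl
  have hAc : IsCompact (closure A) := by
    refine BoundedContinuousFunction.arzela_ascoli _ hcpt A (fun v ξ hv => hv.1 ξ) ?_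
    exact (LipschitzWith.uniformEquicontinuous _ L fun v => v.2.2).equicontinuous
  -- The δ-net is taken inside `A`, so that its members can be retracted; the constant default in
  -- `toN` is never met on it.
  obtain ⟨t, htA, htfin, htcov⟩ :=
    (hAc.totallyBounded.subset subset_closure).exists_subset (dist_mem_uniformity hδ)
  set toN : BoundedContinuousFunction (Sph m) W → C(Sph m, N) := fun v =>
    if h : Continuous fun ξ => r (v ξ) then ⟨_, h⟩
    else ContinuousMap.const _ (Classical.arbitrary N)
    with htoN
  refine ⟨toN '' t, htfin.image _, fun v b hv hL hb => ?_⟩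
  have hvA : BoundedContinuousFunction.mkOfCompact v ∈ A := ⟨hv, hL⟩
  obtain ⟨w, hw, hvw⟩ := mem_iUnion₂.1 (htcov hvA)
  have hwA := htA hw
  have hwc : Continuous fun ξ => r (w ξ) :=
    hr.comp_continuous w.continuous fun ξ => (hwA.1 ξ).trans_lt (by linarith)
  refine ⟨toN w, ⟨w, hw, rfl⟩, ?_⟩
  -- The segment between δ-close maps within 2δ of `X` stays in the 3δ-neighbourhood, where `r` is
  -- continuous.
  refine homotopic_of_continuousOn hr
    (fun p : unitInterval × Sph m => v p.2 + (p.1 : ℝ) • (w p.2 - v p.2)) (by fun_prop)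
    (fun p => ?_) _ _ (fun ξ => ?_) (fun ξ => ?_)
  · have h1 : dist (v p.2) (w p.2) < δ :=
      (BoundedContinuousFunction.dist_coe_le_dist p.2).trans_lt hvw
    have h2 : dist (v p.2 + (p.1 : ℝ) • (w p.2 - v p.2)) (v p.2) < δ := by
      rw [dist_eq_norm, add_sub_cancel_left, norm_smul, Real.norm_of_nonneg p.1.2.1]
      rw [dist_comm, dist_eq_norm] at h1
      exact (mul_le_of_le_one_left (norm_nonneg _) p.1.2.2).trans_lt h1
    change infDist _ X < 3 * δ
    have h3 := infDist_le_infDist_add_dist (s := X)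
      (x := v p.2 + (p.1 : ℝ) • (w p.2 - v p.2)) (y := v p.2)
    linarith [hv p.2]
  · simpa using hb ξ
  · simp [htoN, hwc]

end Finiteness

/-! ### Assembly of the decomposition -/

section Main

variable {m : ℕ}

local notation "V" => EuclideanSpace ℝ (Fin (m + 1))
local notation "σ" => Measure.toSphere (volume : Measure V)

/-- The extension by averages of `u` is Lipschitz-continuous on the boundaries of hyperbolic
balls, once these are rescaled to the unit sphere. -/
lemma lipschitzWith_averageExtension_sphere {W : Type*} [NormedAddCommGroup W] [NormedSpace ℝ W]
    (u : C(Sph m, W)) {M K Kmax : ℝ} (hM : ‖u‖ ≤ M) (hK : 0 < K) (hKmax : K ≤ Kmax)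
    {x : V} (hx : ‖x‖ < 1) :
    LipschitzWith (averageLipschitzConst m * M * (4 * (Kmax + 1) * (4 * Kmax + 2))).toNNReal
      fun ξ : Sph m => averageExtension u (hypCenter K x + hypRadius K x • (ξ : V)) := by
  have hR := hypRadius_pos hK hx
  have hL := averageLipschitzConst_pos (m := m)
  have hM0 : 0 ≤ M := (norm_nonneg u).trans hM
  have hnear : ∀ ξ : Sph m, HypNear K x (hypCenter K x + hypRadius K x • (ξ : V)) := fun ξ => by
    rw [← mem_closedBall_hyp_iff hK hx, mem_closedBall, dist_eq_norm, add_sub_cancel_left,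
      norm_smul, norm_eq_of_mem_sphere, mul_one, Real.norm_of_nonneg hR.le]
  refine LipschitzWith.of_dist_le_mul fun ξ ξ' => ?_
  have hK0 : 0 ≤ Kmax := hK.le.trans hKmax
  rw [Real.coe_toNNReal _ (by positivity), dist_eq_norm, Subtype.dist_eq, dist_eq_norm]
  have h1 := (hnear ξ).norm_lt_one hK hx
  have h2 := (hnear ξ').norm_lt_one hK hx
  have h3 := norm_averageExtension_sub_le u h1 h2
  have h4 := hypRadius_le_halfDepth hK hx (hnear ξ)
  have h5 := halfDepth_pos h1
  set y := hypCenter K x + hypRadius K x • (ξ : V) with hy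
  refine h3.trans ?_
  rw [div_le_iff₀ h5, hy, add_sub_add_left_eq_sub, ← smul_sub, norm_smul,
    Real.norm_of_nonneg hR.le, ← hy]
  have h6 : hypRadius K x ≤ 4 * (Kmax + 1) * (4 * Kmax + 2) * halfDepth y :=
    h4.trans (by gcongr)
  calc averageLipschitzConst m * ‖u‖ * (hypRadius K x * ‖(ξ : V) - ξ'‖)
      ≤ averageLipschitzConst m * M *
        ((4 * (Kmax + 1) * (4 * Kmax + 2) * halfDepth y) * ‖(ξ : V) - ξ'‖) := by gcongr
    _ = _ := by ring

/-- The tolerances are nested: δ for pairs outside the gap set, 2δ as the threshold for bad points,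
3δ for the domain of `r`. The constant C depends only on m, δ and the size of `φ`; λ enters through
the bound on the merged balls. -/
lemma exists_decomposition_of_embedding (hm : 1 ≤ m) {N W : Type*} [EMetricSpace N]
    [CompactSpace N] [Nonempty N] [NormedAddCommGroup W] [NormedSpace ℝ W]
    [FiniteDimensional ℝ W] {φ : C(N, W)} {r : W → N} (hrφ : ∀ p, r (φ p) = p) {δ : ℝ} (hδ : 0 < δ)
    (hr : ContinuousOn r {y | infDist y (range φ) < 3 * δ}) {ε : ℝ}
    (hε : ∀ p q, edist p q ≤ ENNReal.ofReal ε → ‖φ p - φ q‖ ≤ δ) :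
    ∃ C : ℝ, 0 < C ∧ ∀ l : ℝ, 0 < l →
        ∃ F : Set C(Sph m, N), F.Finite ∧
          ∀ f : C(Sph m, N), gapPotential ε f ≤ ENNReal.ofReal l →
            ∃ (k : ℕ) (f' : Fin k → C(Sph m, N)),
              (k : ℝ) ≤ C * l ∧ (∀ i, f' i ∈ F) ∧ HasFreeHomotopyDecomposition f f' := by
  classical
  have hWc : CompleteSpace W := FiniteDimensional.complete ℝ W
  have hX : IsCompact (range φ) := isCompact_range φ.continuous
  set M : ℝ := ‖φ‖ with hM
  have hφM : ∀ p, ‖φ p‖ ≤ M := φ.norm_coe_le_norm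
  -- 2M bounds the diameter of the image, and the 1 keeps `D` positive.
  set D : ℝ := 2 * M + 1 with hD
  have hD0 : 0 < D := by positivity
  have hφD : ∀ p q, ‖φ p - φ q‖ ≤ D := fun p q => by
    linarith [norm_sub_le (φ p) (φ q), hφM p, hφM q]
  set C : ℝ := overlapConst m / gapConst m δ D ^ 2 + 1 with hC
  have hC0 : 0 ≤ overlapConst m / gapConst m δ D ^ 2 := div_nonneg overlapConst_nonneg (sq_nonneg _)
  refine ⟨C, by positivity, fun l hl => ?_⟩
  obtain ⟨Kmax, hKmax⟩ := exists_merge (m := m) ⌊C * l⌋₊ 1 one_pos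
  -- The balls removed below have parameter 2K' ≤ 2Kmax, hence the doubled parameter in the
  -- Lipschitz constant.
  obtain ⟨F, hF, hFr⟩ := exists_finite_homotopy_classes (m := m) hX (range_nonempty φ) hδ hr
    (averageLipschitzConst m * M * (4 * (2 * Kmax + 1) * (4 * (2 * Kmax) + 2))).toNNReal
  refine ⟨F, hF, fun f hf => ?_⟩
  set u : C(Sph m, W) := φ.comp f with hu
  have huM : ‖u‖ ≤ M := (ContinuousMap.norm_le _ (norm_nonneg _)).2 fun ξ => hφM _
  set E : Set (Sph m × Sph m) := {p | ENNReal.ofReal ε < edist (f p.2) (f p.1)} with hE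
  have hEm : MeasurableSet E :=
    (isOpen_lt continuous_const (by fun_prop)).measurableSet
  set bad : Set V := {x | 2 * δ ≤ infDist (averageExtension u x) (range φ)} with hbad
  have hbad1 : ∀ x ∈ bad, ‖x‖ < 1 := by
    intro x hx
    by_contra h
    have h1 : 2 * δ ≤ infDist (averageExtension u x) (range φ) := hx
    rw [averageExtension_of_one_le u (not_lt.1 h), infDist_zero_of_mem
      (show u (radialProj x) ∈ range φ from mem_range_self _)] at h1
    linarith
  have hfar : ∀ x ∈ bad, ∀ η, 2 * δ ≤ ‖averageExtension u x - u η‖ := fun x hx η => by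
    rw [← dist_eq_norm]
    exact le_trans hx (infDist_le_dist_of_mem (mem_range_self _))
  have hcard : ∀ s : Finset V, ↑s ⊆ bad → (∀ x ∈ s, ∀ y ∈ s, x ≠ y → ¬ HypNear 1 x y) →
      (s.card : ℝ) ≤ C * l := by
    intro s hs hsep
    refine (card_le_of_separated hm u hD0 hl.le hδ (fun ξ η => hφD _ _) hEm
      (fun ξ η h => hε _ _ (not_lt.1 h)) (fun η h => ?_) hf s (fun x hx => hbad1 x (hs hx))
      (fun x hx => hfar x (hs hx)) (fun x hx y hy hxy => ?_)).trans ?_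
    · simp [hE] at h
    · have := hsep x hx y hy hxy
      rwa [HypNear, not_le, one_mul] at this
    · exact mul_le_mul_of_nonneg_right (by linarith) hl.le
  obtain ⟨s, hsbad, hssep, hsmax⟩ := exists_maximal_separated bad (fun x y => ¬ HypNear 1 x y)
    (fun x y h h' => h h'.symm) ⌊C * l⌋₊ fun s hs hsep => Nat.le_floor (hcard s hs hsep)
  obtain ⟨t, hts, K', hK1, hK2, hcover, hsep⟩ := hKmax s (Nat.le_floor (hcard s hsbad hssep))
    fun x hx => hbad1 x (hsbad hx)
  have hK0 : 0 < K' := by linarith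
  -- Parameter K' already covers the bad points; the strictly larger 2K' puts them in open balls, so
  -- the boundaries are good. Merging separated the centres for this doubled parameter.
  set K := 2 * K' with hK
  have hKpos : 0 < K := by positivity
  have ht1 : ∀ x ∈ t, ‖x‖ < 1 := fun x hx => hbad1 x (hsbad (hts hx))
  set x : Fin t.card → V := fun j => (t.equivFin.symm j : V) with hx
  have hxt : ∀ j, x j ∈ t := fun j => (t.equivFin.symm j).2
  have hx1 : ∀ j, ‖x j‖ < 1 := fun j => ht1 _ (hxt j)
  have hxinj : Function.Injective x := Subtype.val_injective.comp t.equivFin.symm.injective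
  set c : Fin t.card → V := fun j => hypCenter K (x j) with hc
  set R : Fin t.card → ℝ := fun j => hypRadius K (x j) with hR
  have hR0 : ∀ j, 0 < R j := fun j => hypRadius_pos hKpos (hx1 j)
  have hsub : ∀ j, closedBall (c j) (R j) ⊆ ball 0 1 := fun j y hy =>
    mem_ball_zero_iff.2
      (((mem_closedBall_hyp_iff hKpos (hx1 j)).1 hy).norm_lt_one hKpos (hx1 j))
  have hdisj : ∀ i j, i ≠ j → Disjoint (closedBall (c i) (R i)) (closedBall (c j) (R j)) := by
    refine fun i j hij => Set.disjoint_left.2 fun y hy hy' => ?_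
    refine hsep _ (hxt i) _ (hxt j) (hxinj.ne hij) ?_
    exact HypNear.trans hKpos (hx1 i) (mem_ball_zero_iff.1 (hsub i hy)) (hx1 j)
      ((mem_closedBall_hyp_iff hKpos (hx1 i)).1 hy)
      ((mem_closedBall_hyp_iff hKpos (hx1 j)).1 hy').symm
  have hgood : ∀ y ∈ (⋃ j, ball (c j) (R j))ᶜ,
      infDist (averageExtension u y) (range φ) < 2 * δ := by
    intro y hy
    by_contra hyb
    have hybad : y ∈ bad := not_lt.1 hyb
    have hy1 := hbad1 y hybad
    have hex : ∃ z ∈ s, HypNear 1 z y := by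
      obtain ⟨z, hz, h | h⟩ := hsmax y hybad
      · subst h
        refine ⟨z, hz, ?_⟩
        rw [HypNear, sub_self, norm_zero]
        have := one_sub_sq_pos hy1
        nlinarith
      · exact ⟨z, hz, not_not.1 h⟩
    obtain ⟨z, hz, hzy⟩ := hex
    obtain ⟨w, hw, hwy⟩ := hcover z hz y hzy
    refine hy (mem_iUnion.2 ⟨t.equivFin ⟨w, hw⟩, ?_⟩)
    have hxw : x (t.equivFin ⟨w, hw⟩) = w := by simp [hx]
    simp only [hc, hR, hxw]
    exact mem_ball_hyp (by linarith) hKpos (ht1 w hw) hy1 hwy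
  have hG : ContinuousOn (fun y => r (averageExtension u y)) (⋃ j, ball (c j) (R j))ᶜ :=
    hr.comp (continuous_averageExtension u).continuousOn fun y hy =>
      (hgood y hy).trans (by linarith)
  have hsph : ∀ j (ξ : Sph m), c j + R j • (ξ : V) ∈ (⋃ j, ball (c j) (R j))ᶜ := by
    intro j ξ hmem
    obtain ⟨i, hi⟩ := mem_iUnion.1 hmem
    have hn : dist (c j + R j • (ξ : V)) (c j) = R j := by
      rw [dist_eq_norm, add_sub_cancel_left, norm_smul, norm_eq_of_mem_sphere, mul_one,
        Real.norm_of_nonneg (hR0 j).le]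
    by_cases hij : i = j
    · subst hij
      exact absurd (mem_ball.1 hi) (not_lt.2 hn.ge)
    · exact Set.disjoint_left.1 (hdisj i j hij) (ball_subset_closedBall hi)
        (mem_closedBall.2 hn.le)
  set b : Fin t.card → C(Sph m, N) := fun j =>
    ⟨fun ξ => r (averageExtension u (c j + R j • (ξ : V))),
      hG.comp_continuous (by fun_prop) (hsph j)⟩ with hb
  have hdec : HasFreeHomotopyDecomposition f b := by
    refine hasFreeHomotopyDecomposition_of_balls hm hR0 hdisj hsub hG f (fun τ η hτ => ?_) b
      fun j ξ => rfl
    have hτ0 : 0 < τ := by linarith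
    have hn : 1 ≤ ‖τ • (η : V)‖ := by
      rwa [norm_smul, norm_eq_of_mem_sphere, mul_one, Real.norm_of_nonneg hτ0.le]
    rw [averageExtension_of_one_le u hn, radialProj_smul hτ0]
    exact hrφ (f η)
  have hcls : ∀ j, ∃ w ∈ F, (b j).Homotopic w := by
    intro j
    refine hFr ⟨fun ξ => averageExtension u (c j + R j • (ξ : V)),
      (continuous_averageExtension u).comp (by fun_prop)⟩ (b j)
      (fun ξ => (hgood _ (hsph j ξ)).le) ?_ fun ξ => rfl
    exact lipschitzWith_averageExtension_sphere u huM hKpos (by linarith) (hx1 j)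
  choose w hwF hbw using hcls
  exact ⟨t.card, w, (Nat.cast_le.2 (Finset.card_le_card hts)).trans (hcard s hsbad hssep), hwF,
    hdec.of_homotopic_right hbw⟩

end Main

theorem mainTheorem1 (m : ℕ) (hm : 1 ≤ m) (n : ℕ) (N : Type*) [EMetricSpace N]
    [ChartedSpace (EuclideanSpace ℝ (Fin n)) N] [IsManifold (𝓡 n) ∞ N]
    [Bundle.RiemannianBundle (fun x : N => TangentSpace (𝓡 n) x)]
    [IsContMDiffRiemannianBundle (𝓡 n) ∞ (EuclideanSpace ℝ (Fin n))
      (fun x : N => TangentSpace (𝓡 n) x)]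
    [IsRiemannianManifold (𝓡 n) N] [CompactSpace N] :
    ∃ ε₀ : ℝ, 0 < ε₀ ∧ ∀ ε : ℝ, 0 < ε → ε < ε₀ →
      ∃ C : ℝ, 0 < C ∧ ∀ l : ℝ, 0 < l →
        ∃ F : Set C(Sph m, N), F.Finite ∧
          ∀ f : C(Sph m, N), gapPotential ε f ≤ ENNReal.ofReal l →
            ∃ (k : ℕ) (f' : Fin k → C(Sph m, N)),
              (k : ℝ) ≤ C * l ∧ (∀ i, f' i ∈ F) ∧ HasFreeHomotopyDecomposition f f' := by
  rcases isEmpty_or_nonempty N with hN | hN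
  · exact ⟨1, one_pos, fun _ _ _ => ⟨1, one_pos, fun _ _ => ⟨∅, finite_empty,
      fun f => isEmptyElim (f (radialProj 0))⟩⟩⟩
  obtain ⟨q, φ, -, hφ, -⟩ := exists_embedding_euclidean_of_compact (I := 𝓡 n) (M := N)
  obtain ⟨δ, r, hδ, hr, hrφ⟩ :=
    exists_neighborhood_retraction (H := EuclideanSpace ℝ (Fin n)) hφ
  -- The threshold is a modulus of uniform continuity of the embedding: values of `f` that are
  -- ε-close have δ/3-close images.
  obtain ⟨ε₀, hε₀, hε₀φ⟩ := EMetric.uniformContinuous_iff.1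
    (CompactSpace.uniformContinuous_of_continuous hφ.continuous) (ENNReal.ofReal (δ / 3))
    (ENNReal.ofReal_pos.2 (by positivity))
  -- The modulus is an extended real, possibly infinite, so a real number below it is chosen.
  obtain ⟨ε₁, hε₁, hε₁₀⟩ := ENNReal.lt_iff_exists_real_btwn.1 hε₀
  refine ⟨ε₁, ENNReal.ofReal_pos.1 hε₁₀.1, fun ε _ hε => ?_⟩
  refine exists_decomposition_of_embedding hm (φ := ⟨φ, hφ.continuous⟩) hrφ
    (by positivity : 0 < δ / 3) (hr.mono fun y hy => ?_) fun p p' hp => ?_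
  · have : infDist y (range φ) < 3 * (δ / 3) := hy
    change infDist y (range φ) < δ
    linarith
  · have h1 := hε₀φ ((hp.trans (ENNReal.ofReal_le_ofReal hε.le)).trans_lt hε₁₀.2)
    rw [edist_dist, ENNReal.ofReal_lt_ofReal_iff (by positivity), dist_eq_norm] at h1
    exact h1.le
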